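/- For a function $g$ and $m\ge1$ let $C_m(g)=Q_m\,\mathrm{diag}_{0\le j<m}\,g(j\pi/m)\,Q_m^T$ be the DCT-III matrix generated by $g$, where $Q_m=\left[\sqrt{(2-\delta_{j,0})/m}\,\cos\frac{j(i+1/2)\pi}{m}\right]_{i,j=0}^{m-1}$ is the orthogonal cosine transform. Let $q\ge 1$ and let $\tilde f_0$ be a real, even, nonnegative trigonometric polynomial that vanishes exactly on $2\pi\mathbb Z$, with a zero of order $2q$ at $0$. Let $m_0\ge1$ and $s_{\min}\ge 0$ with $2^{s_{\min}}\mid m_0$, and $m_{s+1}=m_s/2$. Put $p(x)=(1+\cos x)^q$ and $f_0=\tilde f_0+c_0\,\chi_{2\pi\mathbb Z}$ with $c_0=\tilde f_0(\pi/m_0)$ (the value at the second grid point), and $$f_{s+1}(x)=\cos^2\!\left(\tfrac x4\right)f_s\!\left(\tfrac x2\right)p^2\!\left(\tfrac x2\right)+\cos^2\!\left(\tfrac{\pi-x/2}{2}\right)f_s\!\left(\pi-\tfrac x2\right)p^2\!\left(\pi-\tfrac x2\right).$$ Let $T^s_{s+1}\in\mathbb R^{m_{s+1}\times m_s}$ be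 the matrix whose row $i$ ($i=0,1,\dots$) has the entry $1/\sqrt2$ in the columns $2i,2i+1$ and zeros elsewhere, $P^s_{s+1}=T^s_{s+1}C_{m_s}(p)$, $A_0=C_{m_0}(f_0)$ and $A_{s+1}=P^s_{s+1}A_s(P^s_{s+1})^H$. One V-cycle for $A_sx=b$ with $s<s_{\min}$ consists of $\nu_{\rm pre}\ge 0$ Richardson pre-smoothing sweeps with iteration matrix $I-\theta_sA_s/\|f_s\|_\infty$, $0<\theta_s\le2$; the coarse grid correction $x\mapsto x-(P^s_{s+1})^Hy$, where $y$ is the result of one V-cycle with zero initial guess for $A_{s+1}y=P^s_{s+1}(A_sx-b)$; and $\nu_{\rm post}\ge1$ Richardson post-smoothing sweeps with iteration matrix $I-A_s/\|f_s\|_\infty$. For $s=s_{\min}$ the system is solved exactly. Here $\|f_s\|_\infty=\sup_{x\in\mathbb R}|f_s(x)|$. Then there is $\rho\in[0,1)$, depending only on $\tilde f_0$ and $q$, such that for all $\nu_{\rm pre}\ge0$, $\nu_{\rm post}\ge1$ and $\theta_s\in(0,2]$ the following holds. 1. For all $m_0$, $s_{\min}$ as above the matrices $A_s$ $(0\le s\le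 s_{\min})$ are positive definite and, if $A_0x=b$ with $b\in\mathbb C^{m_0}$, one V-cycle at level $0$ reduces the error $\|\cdot-x\|_{A_0}$ by at least the factor $\rho$, where $\|v\|_{A}=(v^HAv)^{1/2}$; the V-cycle iterates converge to $x$ from every initial guess. 2. The V-cycle is optimal for the systems $A_0x=b$, over all $m_0$, $s_{\min}$ as above: (a) the arithmetic cost of one V-cycle is at most $C$ times the complexity of a matrix-vector product with $A_0$, with $C$ independent of $m_0$ and $s_{\min}$, and is $O(m_0)$; (b) for every $\varepsilon>0$ there is $K$, independent of $m_0$, $s_{\min}$, $b$ and the initial guess, such that every V-cycle iterate with index $k\ge K$ has error at most $\varepsilon$ times the initial error in the norm $\|\cdot\|_{A_0}$. Here the complexity of the product with a fixed matrix is the least number of arithmetic operations $(+,-,\times,/)$ of a straight-line program over $\mathbb C$ that computes it, each output being the result of an operation. The cost of a V-cycle is the sum, over its steps, of the complexities of the products with $A_s$, $P^s_{s+1}$, $(P^s_{s+1})^H$ and, at the coarsest level, $A_{s_{\min}}^{-1}$, and of the numbers of scalar operations in the vector updates; the matrices, and the constants of these programs, are formed beforehand in a setup phase. -/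

import Mathlib

open scoped Matrix ComplexOrder

noncomputable section

namespace DCTMultigrid

/-! ### Trigonometric polynomials and DCT-III matrices -/

/-- Real trigonometric polynomials (of period `2π`). -/
def IsTrigPoly (f : ℝ → ℝ) : Prop :=
  ∃ (k : ℕ) (a b : ℕ → ℝ),
    ∀ x, f x = ∑ j ∈ Finset.range (k + 1), (a j * Real.cos (j * x) + b j * Real.sin (j * x))

/-- The orthogonal cosine transform. Rows (positions) and columns (frequencies) are numbered from
`0`, so that the constant vector is column `0`. -/
def dctTransform (m : ℕ) : Matrix (Fin m) (Fin m) ℂ :=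
  Matrix.of fun i j =>
    ((Real.sqrt ((if (j : ℕ) = 0 then 1 else 2) / m) *
      Real.cos ((j : ℝ) * ((i : ℝ) + 1 / 2) * Real.pi / m) : ℝ) : ℂ)

/-- The DCT-III matrix of order `m` generated by `f`: its eigenvalues are the values of `f` at the
grid points `j π / m`, `0 ≤ j < m`. -/
def dctMatrix (m : ℕ) (f : ℝ → ℝ) : Matrix (Fin m) (Fin m) ℂ :=
  dctTransform m * Matrix.diagonal (fun j : Fin m => ((f ((j : ℝ) * Real.pi / m) : ℝ) : ℂ)) *
    (dctTransform m)ᵀ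

/-! ### Levels, projectors, generating functions, matrices -/

/-- The size `m_s` at level `s`: `m_{s+1} = m_s / 2`. -/
def levelDim (m₀ : ℕ) : ℕ → ℕ
  | 0 => m₀
  | s + 1 => levelDim m₀ s / 2

/-- The cutting operator: row `i` has the entry `1/√2` in the columns `2 i` and `2 i + 1`
(numbered from `0`), and `0` elsewhere. -/
def cutting (m' m : ℕ) : Matrix (Fin m') (Fin m) ℂ :=
  Matrix.of fun i j =>
    if (j : ℕ) = 2 * (i : ℕ) ∨ (j : ℕ) = 2 * (i : ℕ) + 1 then ((1 / Real.sqrt 2 : ℝ) : ℂ) else 0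

/-- The polynomial `p(x) = (1 + cos x)^q` that generates the projectors. -/
def projPoly (q : ℕ) (x : ℝ) : ℝ := (1 + Real.cos x) ^ q

/-- The projector `P^s_{s+1} = T^s_{s+1} C_{m_s}(p)` from level `s` to level `s + 1`. -/
def projector (q m₀ s : ℕ) :
    Matrix (Fin (levelDim m₀ (s + 1))) (Fin (levelDim m₀ s)) ℂ :=
  cutting (levelDim m₀ (s + 1)) (levelDim m₀ s) * dctMatrix (levelDim m₀ s) (projPoly q)

/-- The Strang-corrected generating function `f + f(π / m₀) χ_{2πℤ}`; here `π / m₀` is the second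
grid point. -/
def strangSymbol (f : ℝ → ℝ) (m₀ : ℕ) (x : ℝ) : ℝ :=
  f x + f (Real.pi / m₀) *
    Set.indicator {y : ℝ | ∃ k : ℤ, y = 2 * Real.pi * k} (fun _ => (1 : ℝ)) x

/-- The generating functions `f_s` of the matrices at the levels `s = 0, 1, 2, …`. -/
def levelSymbol (f : ℝ → ℝ) (q m₀ : ℕ) : ℕ → ℝ → ℝ
  | 0 => strangSymbol f m₀
  | s + 1 => fun x =>
      Real.cos ((x / 2) / 2) ^ 2 * levelSymbol f q m₀ s (x / 2) * projPoly q (x / 2) ^ 2 +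
      Real.cos ((Real.pi - x / 2) / 2) ^ 2 * levelSymbol f q m₀ s (Real.pi - x / 2) *
        projPoly q (Real.pi - x / 2) ^ 2

/-- The sup-norm of a (bounded) function on the line. -/
def supNorm (g : ℝ → ℝ) : ℝ := ⨆ x, |g x|

/-- The matrices `A_s`: `A_0` is the DCT-III matrix generated by the corrected function, and
`A_{s+1} = P^s_{s+1} A_s (P^s_{s+1})ᴴ`. -/
def levelMatrix (f : ℝ → ℝ) (q m₀ : ℕ) :
    (s : ℕ) → Matrix (Fin (levelDim m₀ s)) (Fin (levelDim m₀ s)) ℂ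
  | 0 => dctMatrix (levelDim m₀ 0) (strangSymbol f m₀)
  | s + 1 => projector q m₀ s * levelMatrix f q m₀ s * (projector q m₀ s)ᴴ

/-! ### The V-cycle -/

/-- One sweep of the Richardson iteration for `A x = b`, with iteration matrix `I - ω A`. -/
def richardson {m : ℕ} (A : Matrix (Fin m) (Fin m) ℂ) (ω : ℝ) (b x : Fin m → ℂ) : Fin m → ℂ :=
  x - (ω : ℂ) • (A *ᵥ x - b)

/-- The V-cycle started at level `s`, with `l = s_min - s` levels below it: `vcycle … l s x b` is
the new iterate obtained from the iterate `x` for the system `A_s x = b`. There are `νpre` sweeps of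
Richardson pre-smoothing with parameter `θ_s / ‖f_s‖_∞` and `νpost` sweeps of Richardson
post-smoothing with parameter `1 / ‖f_s‖_∞`; on the coarsest level the system is solved exactly. -/
def vcycle (f : ℝ → ℝ) (q m₀ νpre νpost : ℕ) (θ : ℕ → ℝ) :
    (l s : ℕ) → (x b : Fin (levelDim m₀ s) → ℂ) → (Fin (levelDim m₀ s) → ℂ)
  | 0, s, _, b => (levelMatrix f q m₀ s)⁻¹ *ᵥ b
  | l + 1, s, x, b =>
      let A := levelMatrix f q m₀ s
      let P := projector q m₀ s
      let M := supNorm (levelSymbol f q m₀ s)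
      let xpre := (richardson A (θ s / M) b)^[νpre] x
      let r := A *ᵥ xpre - b
      let y := vcycle f q m₀ νpre νpost θ l (s + 1) 0 (P *ᵥ r)
      let xhat := xpre - Pᴴ *ᵥ y
      (richardson A (1 / M) b)^[νpost] xhat

/-! ### Arithmetic cost -/

/-- An operand of an arithmetic instruction: an input variable, a constant, or the result of the
`k`-th instruction. -/
inductive Operand (n : ℕ) where
  | input (i : Fin n)
  | const (c : ℂ)
  | reg (k : ℕ)

/-- The four arithmetic operations. -/
inductive ArithOp where
  | add
  | sub
  | mul
  | div

/-- An arithmetic instruction: one operation applied to two operands. -/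
structure Instr (n : ℕ) where
  op : ArithOp
  left : Operand n
  right : Operand n

/-- The value of an operand, given the inputs and the results of the earlier instructions. -/
def Operand.value {n : ℕ} (x : Fin n → ℂ) (regs : List ℂ) : Operand n → ℂ
  | .input i => x i
  | .const c => c
  | .reg k => regs.getD k 0

/-- The result of an arithmetic operation. -/
def ArithOp.apply : ArithOp → ℂ → ℂ → ℂ
  | .add, u, v => u + v
  | .sub, u, v => u - v
  | .mul, u, v => u * v
  | .div, u, v => u / v

/-- The list of the results of all instructions, executed in order. -/
def runCode {n : ℕ} (x : Fin n → ℂ) (code : List (Instr n)) : List ℂ :=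
  code.foldl
    (fun regs ins => regs ++ [ins.op.apply (ins.left.value x regs) (ins.right.value x regs)]) []

/-- A straight-line program with `n` inputs and `p` outputs; each output is the result of one of
its instructions. -/
structure StraightLineProgram (n p : ℕ) where
  code : List (Instr n)
  out : Fin p → Fin code.length

/-- The output of a straight-line program. -/
def StraightLineProgram.eval {n p : ℕ} (S : StraightLineProgram n p) (x : Fin n → ℂ) :
    Fin p → ℂ :=
  fun i => (runCode x S.code).getD (S.out i) 0

/-- The complexity of the matrix-vector product `x ↦ B x`: the least number of arithmetic
operations of a straight-line program that computes it (the entries of `B`, and constants that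
depend on `B` only, are available for free). -/
def matVecComplexity {n p : ℕ} (B : Matrix (Fin p) (Fin n) ℂ) : ℕ∞ :=
  ⨅ (S : StraightLineProgram n p) (_ : ∀ x, S.eval x = B *ᵥ x), (S.code.length : ℕ∞)

/-- The cost of one Richardson sweep `x - ω (A x - b)`: one product with `A`, two vector
subtractions and one multiplication of a vector by a scalar. -/
def richardsonCost {m : ℕ} (A : Matrix (Fin m) (Fin m) ℂ) : ℕ∞ :=
  matVecComplexity A + 3 * m

/-- The number of arithmetic operations of one V-cycle, summed over its steps: pre-smoothing,
residual, restriction, recursive call, prolongation, correction, post-smoothing; on the coarsest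
level, the exact solution (the matrices themselves are formed beforehand, in a setup phase). -/
def vcycleCost (f : ℝ → ℝ) (q m₀ νpre νpost : ℕ) : (l s : ℕ) → ℕ∞
  | 0, s => matVecComplexity (levelMatrix f q m₀ s)⁻¹
  | l + 1, s =>
      νpre * richardsonCost (levelMatrix f q m₀ s) +
      (matVecComplexity (levelMatrix f q m₀ s) + levelDim m₀ s) +
      matVecComplexity (projector q m₀ s) +
      vcycleCost f q m₀ νpre νpost l (s + 1) +
      (matVecComplexity (projector q m₀ s)ᴴ + levelDim m₀ s) +
      νpost * richardsonCost (levelMatrix f q m₀ s)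

/-! ### Optimality -/

/-- The energy norm `‖x‖_A = ‖A^{1/2} x‖₂ = (xᴴ A x)^{1/2}` of a positive definite matrix `A`. -/
def energyNorm {m : ℕ} (A : Matrix (Fin m) (Fin m) ℂ) (x : Fin m → ℂ) : ℝ :=
  Real.sqrt (star x ⬝ᵥ (A *ᵥ x)).re

/-- Optimality of an iterative method for a family of linear systems `A_i x = b`. The method is
given by its step `step i b : x ↦ xnew` and by the arithmetic cost of one step.
(1) The cost of a step is at most proportional to the complexity of the product of `A_i` with a
vector. (2) The number of steps that reduce the error, in the energy norm, by a prescribed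
factor `ε` is bounded independently of the system. -/
def IsOptimal {ι : Type} (dim : ι → ℕ) (A : (i : ι) → Matrix (Fin (dim i)) (Fin (dim i)) ℂ)
    (step : (i : ι) → (b x : Fin (dim i) → ℂ) → (Fin (dim i) → ℂ)) (cost : ι → ℕ∞) : Prop :=
  (∃ C : ℕ, ∀ i, cost i ≤ C * matVecComplexity (A i)) ∧
  (∀ ε : ℝ, 0 < ε → ∃ K : ℕ, ∀ (i : ι) (b x x₀ : Fin (dim i) → ℂ), A i *ᵥ x = b →
    ∀ k : ℕ, K ≤ k →
      energyNorm (A i) ((step i b)^[k] x₀ - x) ≤ ε * energyNorm (A i) (x₀ - x))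

/-- The admissible grid hierarchies: a finest size `m₀ ≥ 1` and an index `sMin` of the coarsest
level such that the size can be halved `sMin` times. -/
structure Hierarchy where
  m₀ : ℕ
  sMin : ℕ
  pos : 0 < m₀
  dvd : 2 ^ sMin ∣ m₀

end DCTMultigrid

end

/-!
The cosine transform `Q` diagonalizes everything. Restriction maps the fine frequencies `k` and
`m - k` to the coarse frequency `k` and kills `m/2` (`cutting_mul_dctTransform`); hence every `A_s`
is again the DCT-III matrix of its symbol `f_s`
(`galerkin_dctMatrix`, `levelMatrix_eq_dctMatrix`).

*Symbols.* Up to the Strang correction, `f_s (x) = F_s (cos x)` with polynomials `F_s` of bounded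
degree. Writing `F_s (t) = g_s (t) (1 - t)^q` and `u = cos² (x/4)`, the recursion reads
`g_{s+1} (cos x) = u^{q+1} g_s (cos (x/2)) + (1 - u)^{q+1} g_s (-cos (x/2))`. So upper bounds are
preserved because `u^{q+1} + (1 - u)^{q+1} ≤ 1`, and lower bounds of the form
`a (sin (x/2) / (x/2))^{2(q+1)}` are preserved by the first term alone, by the duplication formula
for the sine (`levelSymbol_form`). The correction at level `s` is
`4^{qs} f (π/m₀) ≤ b (π²/2)^q` because `2^s ≤ m₀`. All levels are therefore controlled by the same
constants (`levelSymbol_bounds`).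

*Convergence.* Each level has the strong approximation property
`min_w ‖u - Pᴴ w‖²_A ≤ γ ‖A u‖²` (`exists_coarse_approximation`: interpolate the low frequencies
exactly), and post-smoothing gains `‖A u‖² / M` in the squared energy norm, `M = ‖f_s‖_∞`. For the
error `u` after the coarse grid correction, the first estimate bounds the energy of the component
that is `A`-orthogonal to the range of `Pᴴ`, and this component is untouched by the recursion; the
other component is reduced by the recursive call. With `κ ≥ M γ` on all levels, induction gives the
factor `ρ² = 1 - 1/κ` for the squared energy norm (`energy_coarse_correction_le`,
`vcycle_energy_le`). Pre-smoothing is only used to be nonexpansive.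

*Cost.* Over `ℂ` a polynomial in the cosine splits into linear factors. The matrix of `cos - z` is
tridiagonal, and its (pseudo-)inverse is forward substitution plus corrections of rank one
(`hasCost_gridCos_sub_inv`), hence `A_s` and `A_s⁻¹` cost `O(m_s)` operations
(`hasCost_polynomial`), the projectors do too, and the V-cycle costs a geometric sum
(`vcycleCost_le`). Conversely the product with an invertible matrix of order `m` needs at least `m`
operations (`le_matVecComplexity`).
-/

open scoped Matrix ComplexOrder

namespace DCTMultigrid

/-! ### The cosine transform -/

/-- Multiplied by `2 sin (l π / (2 m))`, the sum telescopes. -/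
theorem sum_cos_midpoints {m : ℕ} (hm : 0 < m) (l : ℤ) (hl : ¬ (2 * (m : ℤ)) ∣ l) :
    ∑ i : Fin m, Real.cos ((l : ℝ) * ((i : ℝ) + 1 / 2) * Real.pi / m) = 0 := by
  have hm' : (m : ℝ) ≠ 0 := by positivity
  have hs : Real.sin (l * Real.pi / (2 * m)) ≠ 0 := by
    intro h
    obtain ⟨n, hn⟩ := Real.sin_eq_zero_iff.1 h
    refine hl ⟨n, ?_⟩
    have h2 : (l : ℝ) = 2 * m * n := by
      field_simp at hn
      linarith
    exact_mod_cast h2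
  have key : ∀ i : ℕ, 2 * Real.sin (l * Real.pi / (2 * m)) *
      Real.cos ((l : ℝ) * ((i : ℝ) + 1 / 2) * Real.pi / m) =
      Real.sin (l * ((i + 1 : ℕ) : ℝ) * Real.pi / m) - Real.sin (l * (i : ℝ) * Real.pi / m) := by
    intro i
    rw [Real.sin_sub_sin]
    congr 2
    · congr 1
      push_cast
      field_simp
      ring
    · push_cast
      field_simp
      ring
  have h0 : 2 * Real.sin (l * Real.pi / (2 * m)) *
      ∑ i : Fin m, Real.cos ((l : ℝ) * ((i : ℝ) + 1 / 2) * Real.pi / m) = 0 := by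
    rw [Finset.mul_sum, Finset.sum_congr rfl fun (i : Fin m) _ => key i,
      Fin.sum_univ_eq_sum_range (fun i : ℕ => Real.sin (l * ((i + 1 : ℕ) : ℝ) * Real.pi / m) -
        Real.sin (l * (i : ℝ) * Real.pi / m)) m,
      Finset.sum_range_sub (fun i : ℕ => Real.sin (l * (i : ℝ) * Real.pi / m)) m]
    have : (l : ℝ) * m * Real.pi / m = l * Real.pi := by field_simp
    rw [this, Real.sin_int_mul_pi]
    simp
  exact (mul_eq_zero.1 h0).resolve_left (mul_ne_zero two_ne_zero hs)

theorem dctTransform_transpose_mul_self (m : ℕ) :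
    (dctTransform m)ᵀ * dctTransform m = 1 := by
  rcases Nat.eq_zero_or_pos m with rfl | hm
  · ext i; exact i.elim0
  have hm' : (m : ℝ) ≠ 0 := by positivity
  ext j k
  rw [Matrix.mul_apply, Matrix.one_apply]
  have hprod : ∀ i : Fin m,
      Real.cos ((j : ℝ) * ((i : ℝ) + 1 / 2) * Real.pi / m) *
        Real.cos ((k : ℝ) * ((i : ℝ) + 1 / 2) * Real.pi / m) =
      (Real.cos ((((j : ℕ) - (k : ℕ) : ℤ) : ℝ) * ((i : ℝ) + 1 / 2) * Real.pi / m) +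
        Real.cos ((((j : ℕ) + (k : ℕ) : ℤ) : ℝ) * ((i : ℝ) + 1 / 2) * Real.pi / m)) / 2 := by
    intro i
    have e1 : (((j : ℕ) - (k : ℕ) : ℤ) : ℝ) * ((i : ℝ) + 1 / 2) * Real.pi / m =
      (j : ℝ) * ((i : ℝ) + 1 / 2) * Real.pi / m - (k : ℝ) * ((i : ℝ) + 1 / 2) * Real.pi / m := by
      push_cast; ring
    have e2 : (((j : ℕ) + (k : ℕ) : ℤ) : ℝ) * ((i : ℝ) + 1 / 2) * Real.pi / m =
      (j : ℝ) * ((i : ℝ) + 1 / 2) * Real.pi / m + (k : ℝ) * ((i : ℝ) + 1 / 2) * Real.pi / m := by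
      push_cast; ring
    rw [e1, e2, Real.cos_sub, Real.cos_add]
    ring
  have hsum : ∑ i : Fin m, (Real.cos ((j : ℝ) * ((i : ℝ) + 1 / 2) * Real.pi / m) *
        Real.cos ((k : ℝ) * ((i : ℝ) + 1 / 2) * Real.pi / m)) =
      if j = k then (if (j : ℕ) = 0 then (m : ℝ) else m / 2) else 0 := by
    rw [Finset.sum_congr rfl fun i _ => hprod i, ← Finset.sum_div, Finset.sum_add_distrib]
    by_cases hjk : j = k
    · subst hjk
      by_cases hj : (j : ℕ) = 0
      · simp [hj]
      · rw [sum_cos_midpoints hm ((j : ℕ) + (j : ℕ) : ℤ)]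
        · simp [hj]
        · rintro ⟨n, hn⟩
          have hj2 := j.2
          have : (j : ℤ) = m * n := by linarith
          have hn0 : 0 < n := by
            by_contra h
            have : (m : ℤ) * n ≤ 0 := by nlinarith
            omega
          have : (m : ℤ) * 1 ≤ m * n := by gcongr; omega
          omega
    · have hne : (j : ℕ) ≠ k := fun h => hjk (Fin.ext h)
      have hj2 := j.2
      have hk2 := k.2
      rw [sum_cos_midpoints hm ((j : ℕ) + (k : ℕ) : ℤ),
        sum_cos_midpoints hm ((j : ℕ) - (k : ℕ) : ℤ)]
      · simp [hjk]
      · intro h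
        have := Int.eq_zero_of_abs_lt_dvd h (by rw [abs_lt]; omega)
        omega
      · intro h
        have := Int.eq_zero_of_abs_lt_dvd h (by rw [abs_lt]; omega)
        omega
  have hcast : ∑ i, (dctTransform m)ᵀ j i * dctTransform m i k =
      ((Real.sqrt ((if (j : ℕ) = 0 then 1 else 2) / m) *
        Real.sqrt ((if (k : ℕ) = 0 then 1 else 2) / m)
        * ∑ i : Fin m, (Real.cos ((j : ℝ) * ((i : ℝ) + 1 / 2) * Real.pi / m) *
        Real.cos ((k : ℝ) * ((i : ℝ) + 1 / 2) * Real.pi / m)) : ℝ) : ℂ) := by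
    rw [Finset.mul_sum, Complex.ofReal_sum]
    refine Finset.sum_congr rfl fun i _ => ?_
    simp only [dctTransform, Matrix.transpose_apply, Matrix.of_apply]
    rw [← Complex.ofReal_mul]
    congr 1
    ring
  rw [hcast, hsum]
  by_cases hjk : j = k
  · subst hjk
    simp only [if_true]
    rw [Real.mul_self_sqrt (by positivity)]
    by_cases hj : (j : ℕ) = 0
    · simp [hj, hm'] 
    · simp only [hj, if_false]
      rw [show (2 : ℝ) / m * (m / 2) = 1 by field_simp]
      simp
  · simp [hjk]

theorem dctTransform_mul_transpose_self (m : ℕ) :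
    dctTransform m * (dctTransform m)ᵀ = 1 :=
  mul_eq_one_comm.1 (dctTransform_transpose_mul_self m)

theorem dctTransform_conjTranspose (m : ℕ) : (dctTransform m)ᴴ = (dctTransform m)ᵀ := by
  ext i j
  simp only [dctTransform, Matrix.conjTranspose_apply, Matrix.transpose_apply, Matrix.of_apply]
  exact Complex.conj_ofReal _

/-- The matrix that the cosine transform diagonalizes, with the eigenvalues `d`. -/
noncomputable def cosMatrix (m : ℕ) (d : Fin m → ℂ) : Matrix (Fin m) (Fin m) ℂ :=
  dctTransform m * Matrix.diagonal d * (dctTransform m)ᵀ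

theorem dctMatrix_eq_cosMatrix (m : ℕ) (g : ℝ → ℝ) :
    dctMatrix m g = cosMatrix m fun j => ((g ((j : ℝ) * Real.pi / m) : ℝ) : ℂ) := rfl

theorem cosMatrix_mul (m : ℕ) (d e : Fin m → ℂ) :
    cosMatrix m d * cosMatrix m e = cosMatrix m (fun j => d j * e j) := by
  have : ∀ Q D E R : Matrix (Fin m) (Fin m) ℂ,
      Q * D * R * (Q * E * R) = Q * D * (R * Q) * E * R := by
    intros; noncomm_ring
  rw [cosMatrix, cosMatrix, this, dctTransform_transpose_mul_self, Matrix.mul_one,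
    Matrix.mul_assoc (dctTransform m), Matrix.diagonal_mul_diagonal]
  rfl

theorem cosMatrix_one (m : ℕ) : cosMatrix m (fun _ => 1) = 1 := by
  rw [cosMatrix, Matrix.diagonal_one, Matrix.mul_one, dctTransform_mul_transpose_self]

theorem cosMatrix_add (m : ℕ) (d e : Fin m → ℂ) :
    cosMatrix m (fun j => d j + e j) = cosMatrix m d + cosMatrix m e := by
  rw [cosMatrix, ← Matrix.diagonal_add, Matrix.mul_add, Matrix.add_mul]
  rfl

theorem cosMatrix_smul (m : ℕ) (c : ℂ) (d : Fin m → ℂ) :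
    cosMatrix m (fun j => c * d j) = c • cosMatrix m d := by
  have : Matrix.diagonal (fun j => c * d j) = c • Matrix.diagonal d := by
    rw [← Matrix.diagonal_smul]; rfl
  rw [cosMatrix, this, Matrix.mul_smul, Matrix.smul_mul, cosMatrix]

theorem cosMatrix_sub (m : ℕ) (d e : Fin m → ℂ) :
    cosMatrix m (fun j => d j - e j) = cosMatrix m d - cosMatrix m e := by
  rw [cosMatrix, ← Matrix.diagonal_sub, Matrix.mul_sub, Matrix.sub_mul]
  rfl

theorem cosMatrix_inv (m : ℕ) (d : Fin m → ℂ) (hd : ∀ j, d j ≠ 0) :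
    (cosMatrix m d)⁻¹ = cosMatrix m (fun j => (d j)⁻¹) := by
  refine Matrix.inv_eq_right_inv ?_
  rw [cosMatrix_mul, ← cosMatrix_one]
  congr 1
  ext j
  exact mul_inv_cancel₀ (hd j)

theorem cosMatrix_posDef {m : ℕ} {d : Fin m → ℝ} (hd : ∀ j, 0 < d j) :
    (cosMatrix m fun j => (d j : ℂ)).PosDef := by
  rw [cosMatrix, ← dctTransform_conjTranspose]
  refine Matrix.PosDef.mul_mul_conjTranspose_same
    (Matrix.PosDef.diagonal fun j => Complex.zero_lt_real.2 (hd j)) ?_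
  refine Function.LeftInverse.injective (g := fun v => v ᵥ* (dctTransform m)ᵀ) fun v => ?_
  change (v ᵥ* dctTransform m) ᵥ* (dctTransform m)ᵀ = v
  rw [Matrix.vecMul_vecMul, dctTransform_mul_transpose_self, Matrix.vecMul_one]

/-- The cosine coefficients of a vector. -/
noncomputable def coeff {m : ℕ} (v : Fin m → ℂ) : Fin m → ℂ := (dctTransform m)ᵀ *ᵥ v

theorem dctTransform_mulVec_coeff {m : ℕ} (v : Fin m → ℂ) : dctTransform m *ᵥ coeff v = v := by
  rw [coeff, Matrix.mulVec_mulVec, dctTransform_mul_transpose_self, Matrix.one_mulVec]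

theorem coeff_dctTransform_mulVec {m : ℕ} (v : Fin m → ℂ) : coeff (dctTransform m *ᵥ v) = v := by
  rw [coeff, Matrix.mulVec_mulVec, dctTransform_transpose_mul_self, Matrix.one_mulVec]

theorem coeff_sub {m : ℕ} (u v : Fin m → ℂ) : coeff (u - v) = coeff u - coeff v :=
  Matrix.mulVec_sub _ _ _

theorem coeff_smul {m : ℕ} (c : ℂ) (v : Fin m → ℂ) : coeff (c • v) = c • coeff v :=
  Matrix.mulVec_smul _ _ _

theorem coeff_cosMatrix_mulVec {m : ℕ} (d v : Fin m → ℂ) (j : Fin m) :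
    coeff (cosMatrix m d *ᵥ v) j = d j * coeff v j := by
  rw [cosMatrix, ← Matrix.mulVec_mulVec, ← Matrix.mulVec_mulVec, coeff_dctTransform_mulVec,
    Matrix.mulVec_diagonal]
  rfl

/-- Parseval's identity. -/
theorem star_dotProduct_eq_coeff {m : ℕ} (u v : Fin m → ℂ) :
    star u ⬝ᵥ v = star (coeff u) ⬝ᵥ coeff v := by
  conv_lhs => rw [← dctTransform_mulVec_coeff u]
  rw [Matrix.star_mulVec, dctTransform_conjTranspose, ← Matrix.dotProduct_mulVec]
  rfl

/-! ### The cosine matrix with symbol `cos` -/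

/-- The left neighbour of a position; position `0` is its own left neighbour. -/
def leftNbr {m : ℕ} (i : Fin m) : Fin m := ⟨i - 1, by omega⟩

/-- The right neighbour of a position; the last position is its own right neighbour. -/
def rightNbr {m : ℕ} (i : Fin m) : Fin m := ⟨min (i + 1) (m - 1), by omega⟩

theorem dctTransform_nbrs {m : ℕ} (i j : Fin m) :
    dctTransform m (leftNbr i) j + dctTransform m (rightNbr i) j =
      2 * (Real.cos ((j : ℝ) * Real.pi / m) : ℂ) * dctTransform m i j := by
  have hm' : (m : ℝ) ≠ 0 := by have := i.2; have : 0 < m := by omega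
                               positivity
  have hl : Real.cos ((j : ℝ) * (((leftNbr i : Fin m) : ℕ) + 1 / 2) * Real.pi / m) =
      Real.cos ((j : ℝ) * ((i : ℝ) + 1 / 2) * Real.pi / m - (j : ℝ) * Real.pi / m) := by
    rcases Nat.eq_zero_or_pos (i : ℕ) with h | h
    · rw [leftNbr, ← Real.cos_neg]
      simp only [h]
      congr 1
      push_cast
      ring
    · have : (((i : ℕ) - 1 : ℕ) : ℝ) = (i : ℝ) - 1 := by
        rw [Nat.cast_sub h]; simp
      simp only [leftNbr, this]
      congr 1
      ring
  have hr : Real.cos ((j : ℝ) * (((rightNbr i : Fin m) : ℕ) + 1 / 2) * Real.pi / m) =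
      Real.cos ((j : ℝ) * ((i : ℝ) + 1 / 2) * Real.pi / m + (j : ℝ) * Real.pi / m) := by
    have hi := i.2
    rcases Nat.lt_or_ge ((i : ℕ) + 1) m with h | h
    · have : min ((i : ℕ) + 1) (m - 1) = i + 1 := by omega
      simp only [rightNbr, this]
      congr 1
      push_cast
      ring
    · have : min ((i : ℕ) + 1) (m - 1) = i := by omega
      simp only [rightNbr, this]
      have hi' : (i : ℝ) = m - 1 := by
        have : (((i : ℕ) + 1 : ℕ) : ℝ) = m := by congr 1; omega
        rw [← this]; simp
      rw [hi', ← Real.cos_nat_mul_two_pi_sub _ j]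
      congr 1
      field_simp
      ring
  simp only [dctTransform, Matrix.of_apply]
  rw [hl, hr, Real.cos_sub, Real.cos_add]
  push_cast
  ring

/-- The matrix generated by `cos` averages the two neighbours. -/
theorem cosMatrix_cos_mulVec {m : ℕ} (v : Fin m → ℂ) (i : Fin m) :
    (cosMatrix m (fun j => (Real.cos ((j : ℝ) * Real.pi / m) : ℂ)) *ᵥ v) i =
      (v (leftNbr i) + v (rightNbr i)) / 2 := by
  have h : ∀ (w : Fin m → ℂ) (i : Fin m), w i = ∑ j, dctTransform m i j * coeff w j := fun w i =>
    (congrFun (dctTransform_mulVec_coeff w) i).symm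
  rw [h (cosMatrix m _ *ᵥ v) i, h v (leftNbr i), h v (rightNbr i), ← Finset.sum_add_distrib,
    Finset.sum_div]
  refine Finset.sum_congr rfl fun j _ => ?_
  rw [coeff_cosMatrix_mulVec, ← add_mul, dctTransform_nbrs]
  ring

/-! ### Restriction in the cosine basis -/

/-- The aliasing of frequencies under restriction from `m` to `m' = m / 2` points: the frequency `k`
of the coarse grid receives the frequency `k` of the fine grid and, with the opposite sign,
the frequency `m - k`. -/
def aliasMatrix (m' m : ℕ) : Matrix (Fin m') (Fin m) ℂ :=
  Matrix.of fun k j => if (j : ℕ) = k then 1 else if (j : ℕ) + k = m then -1 else 0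

theorem cutting_mulVec {m' m : ℕ} (hm : m = 2 * m') (v : Fin m → ℂ) (i : Fin m') :
    (cutting m' m *ᵥ v) i =
      ((1 / Real.sqrt 2 : ℝ) : ℂ) * (v ⟨2 * i, by omega⟩ + v ⟨2 * i + 1, by omega⟩) := by
  simp only [Matrix.mulVec, dotProduct, cutting, Matrix.of_apply]
  rw [← Finset.sum_subset (Finset.subset_univ
    {(⟨2 * i, by omega⟩ : Fin m), (⟨2 * i + 1, by omega⟩ : Fin m)})]
  · rw [Finset.sum_pair (by simp)]
    simp [mul_add]
  · intro j _ hj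
    simp only [Finset.mem_insert, Finset.mem_singleton, Fin.ext_iff] at hj
    rw [if_neg hj, zero_mul]

theorem cutting_conjTranspose_mulVec {m' m : ℕ} (hm : m = 2 * m') (w : Fin m' → ℂ) (j : Fin m) :
    ((cutting m' m)ᴴ *ᵥ w) j = ((1 / Real.sqrt 2 : ℝ) : ℂ) * w ⟨j / 2, by omega⟩ := by
  simp only [Matrix.mulVec, dotProduct, cutting, Matrix.conjTranspose_apply, Matrix.of_apply]
  rw [Finset.sum_eq_single ⟨j / 2, by omega⟩]
  · rw [if_pos (by simp only; omega)]
    congr 1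
    exact Complex.conj_ofReal _
  · intro i _ hi
    rw [Ne, Fin.ext_iff] at hi
    rw [if_neg (by simp only at hi; omega)]
    simp
  · intro h
    exact absurd (Finset.mem_univ _) h

/-- The sum of a column of the aliasing matrix against a vector. -/
theorem sum_aliasMatrix_mul {m' m : ℕ} (hm : m = 2 * m') (w : Fin m' → ℂ) (j : Fin m) :
    ∑ k, aliasMatrix m' m k j * w k =
      if h : (j : ℕ) < m' then w ⟨j, h⟩
      else if h : m' < j then -w ⟨m - j, by omega⟩ else 0 := by
  have hj := j.2
  simp only [aliasMatrix, Matrix.of_apply]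
  split_ifs with h1 h2
  · rw [Finset.sum_eq_single ⟨j, h1⟩]
    · simp
    · intro k _ hk
      rw [Ne, Fin.ext_iff] at hk
      rw [if_neg (fun h => hk h.symm), if_neg (by have := k.2; omega), zero_mul]
    · intro h
      exact absurd (Finset.mem_univ _) h
  · rw [Finset.sum_eq_single ⟨m - j, by omega⟩]
    · rw [if_neg (by simp only; omega), if_pos (by simp only; omega), neg_one_mul]
    · intro k _ hk
      rw [Ne, Fin.ext_iff] at hk
      simp only at hk
      rw [if_neg (by omega), if_neg (by omega), zero_mul]
    · intro h
      exact absurd (Finset.mem_univ _) h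
  · refine Finset.sum_eq_zero fun k _ => ?_
    rw [if_neg (by omega), if_neg (by omega), zero_mul]

/-- Adding neighbouring values of a cosine gives the cosine at the midpoint, times the cosine of
half the frequency; the frequency `m / 2` is killed. -/
theorem cutting_mul_dctTransform {m' m : ℕ} (hm : m = 2 * m') :
    cutting m' m * dctTransform m = dctTransform m' * aliasMatrix m' m *
      Matrix.diagonal (fun j : Fin m => (Real.cos ((j : ℝ) * Real.pi / m / 2) : ℂ)) := by
  ext i j
  have hm'0 : (m' : ℝ) ≠ 0 := by
    have := i.2
    have : 0 < m' := by omega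
    positivity
  have hmr : (m : ℝ) = 2 * m' := by rw [hm]; push_cast; ring
  have hL : (cutting m' m * dctTransform m) i j =
      (cutting m' m *ᵥ fun l => dctTransform m l j) i := rfl
  have hR : (dctTransform m' * aliasMatrix m' m) i j =
      ∑ k, aliasMatrix m' m k j * dctTransform m' i k := by
    rw [Matrix.mul_apply]
    exact Finset.sum_congr rfl fun k _ => mul_comm _ _
  rw [hL, cutting_mulVec hm, Matrix.mul_diagonal, hR, sum_aliasMatrix_mul hm]
  simp only [dctTransform, Matrix.of_apply]
  have hsum : Real.cos ((j : ℝ) * (((2 * (i : ℕ) : ℕ) : ℝ) + 1 / 2) * Real.pi / m) +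
      Real.cos ((j : ℝ) * (((2 * (i : ℕ) + 1 : ℕ) : ℝ) + 1 / 2) * Real.pi / m) =
      2 * Real.cos ((j : ℝ) * ((i : ℝ) + 1 / 2) * Real.pi / m') *
        Real.cos ((j : ℝ) * Real.pi / m / 2) := by
    rw [Real.cos_add_cos, ← Real.cos_neg ((_ - _) / 2)]
    congr 2
    · congr 1
      rw [hmr]
      push_cast
      field_simp
      ring
    · rw [hmr]
      push_cast
      field_simp
      ring
  have hsqrt : ∀ c : ℝ, 0 ≤ c → 1 / Real.sqrt 2 * (Real.sqrt (c / m) * 2) = Real.sqrt (c / m') := by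
    intro c hc
    have h2 : Real.sqrt 2 * Real.sqrt 2 = 2 := Real.mul_self_sqrt (by norm_num)
    have h3 : c / m' = 2 * (c / m) := by rw [hmr]; field_simp
    rw [h3, Real.sqrt_mul (by norm_num)]
    field_simp
    rw [← sq] at h2
    rw [h2, mul_comm]
  have hpos : (0 : ℝ) ≤ if (j : ℕ) = 0 then 1 else 2 := by split_ifs <;> norm_num
  rw [← Complex.ofReal_add, ← mul_add, hsum, ← Complex.ofReal_mul]
  have hL2 : 1 / Real.sqrt 2 * (Real.sqrt ((if (j : ℕ) = 0 then 1 else 2) / m) *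
      (2 * Real.cos ((j : ℝ) * ((i : ℝ) + 1 / 2) * Real.pi / m') *
        Real.cos ((j : ℝ) * Real.pi / m / 2))) =
      Real.sqrt ((if (j : ℕ) = 0 then 1 else 2) / m') *
        Real.cos ((j : ℝ) * ((i : ℝ) + 1 / 2) * Real.pi / m') *
        Real.cos ((j : ℝ) * Real.pi / m / 2) := by
    rw [← hsqrt _ hpos]; ring
  rw [hL2, Complex.ofReal_mul]
  congr 1
  by_cases h1 : (j : ℕ) < m'
  · rw [dif_pos h1]
  by_cases h2 : m' < (j : ℕ)
  · -- the frequencies `j` and `m - j` agree on the coarse grid up to the sign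
    have hj := j.2
    have h3 : ¬ (j : ℕ) = 0 := by omega
    have h4 : ¬ m - (j : ℕ) = 0 := by omega
    rw [dif_neg h1, dif_pos h2, if_neg h3, if_neg h4, ← Complex.ofReal_neg, ← mul_neg,
      Nat.cast_sub j.2.le, hmr]
    have : (2 * m' - (j : ℝ)) * ((i : ℝ) + 1 / 2) * Real.pi / m' =
        (Real.pi - (j : ℝ) * ((i : ℝ) + 1 / 2) * Real.pi / m') + (i : ℕ) * (2 * Real.pi) := by
      field_simp
      ring
    rw [this, Real.cos_add_nat_mul_two_pi, Real.cos_pi_sub, neg_neg]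
  · rw [dif_neg h1, dif_neg h2]
    have hj : (j : ℝ) = m' := by
      congr 1; omega
    rw [hj]
    have : (m' : ℝ) * ((i : ℝ) + 1 / 2) * Real.pi / m' = Real.pi / 2 + (i : ℕ) * Real.pi := by
      field_simp
      ring
    rw [this, Real.cos_add_nat_mul_pi, Real.cos_pi_div_two]
    simp

/-- The eigenvalue of the restriction at a frequency of the fine grid. -/
noncomputable def cutSymbol (m : ℕ) (p : ℝ → ℝ) (j : ℕ) : ℝ :=
  Real.cos ((j : ℝ) * Real.pi / m / 2) * p ((j : ℝ) * Real.pi / m)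

theorem restriction_eq {m' m : ℕ} (hm : m = 2 * m') (p : ℝ → ℝ) :
    cutting m' m * dctMatrix m p = dctTransform m' *
      (aliasMatrix m' m * Matrix.diagonal (fun j : Fin m => (cutSymbol m p j : ℂ))) *
        (dctTransform m)ᵀ := by
  have h : (fun j : Fin m => (cutSymbol m p j : ℂ)) = fun j : Fin m =>
      (Real.cos ((j : ℝ) * Real.pi / m / 2) : ℂ) * (p ((j : ℝ) * Real.pi / m) : ℂ) := by
    ext j; simp [cutSymbol]
  rw [h, ← Matrix.diagonal_mul_diagonal, dctMatrix, ← Matrix.mul_assoc, ← Matrix.mul_assoc,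
    cutting_mul_dctTransform hm]
  simp only [Matrix.mul_assoc]

theorem aliasMatrix_conjTranspose (m' m : ℕ) : (aliasMatrix m' m)ᴴ = (aliasMatrix m' m)ᵀ := by
  ext j k
  simp only [aliasMatrix, Matrix.conjTranspose_apply, Matrix.transpose_apply, Matrix.of_apply]
  split_ifs <;> simp

theorem prolongation_eq {m' m : ℕ} (hm : m = 2 * m') (p : ℝ → ℝ) :
    (cutting m' m * dctMatrix m p)ᴴ = dctTransform m *
      (Matrix.diagonal (fun j : Fin m => (cutSymbol m p j : ℂ)) * (aliasMatrix m' m)ᵀ) *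
        (dctTransform m')ᵀ := by
  have hd : (Matrix.diagonal (fun j : Fin m => (cutSymbol m p j : ℂ)))ᴴ =
      Matrix.diagonal (fun j : Fin m => (cutSymbol m p j : ℂ)) := by
    rw [Matrix.diagonal_conjTranspose]
    congr 1
    ext j
    exact Complex.conj_ofReal _
  have ht : ((dctTransform m)ᵀ)ᴴ = dctTransform m := by
    rw [← dctTransform_conjTranspose, Matrix.conjTranspose_conjTranspose]
  rw [restriction_eq hm, Matrix.conjTranspose_mul, Matrix.conjTranspose_mul,
    Matrix.conjTranspose_mul, hd, ht, aliasMatrix_conjTranspose, dctTransform_conjTranspose]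
  simp only [Matrix.mul_assoc]

theorem coeff_prolongation {m' m : ℕ} (hm : m = 2 * m') (p : ℝ → ℝ) (w : Fin m' → ℂ) (j : Fin m) :
    coeff ((cutting m' m * dctMatrix m p)ᴴ *ᵥ w) j = cutSymbol m p j *
      if h : (j : ℕ) < m' then coeff w ⟨j, h⟩
      else if h : m' < j then -coeff w ⟨m - j, by omega⟩ else 0 := by
  rw [prolongation_eq hm, Matrix.mul_assoc, ← Matrix.mulVec_mulVec, coeff_dctTransform_mulVec,
    Matrix.mul_assoc, ← Matrix.mulVec_mulVec, Matrix.mulVec_diagonal, ← Matrix.mulVec_mulVec,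
    ← sum_aliasMatrix_mul hm]
  rfl

theorem aliasMatrix_diagonal {m' m : ℕ} (hm : m = 2 * m') (e : ℕ → ℂ) (he : e m = 0) :
    aliasMatrix m' m * Matrix.diagonal (fun j : Fin m => e j) * (aliasMatrix m' m)ᵀ =
      Matrix.diagonal (fun k : Fin m' => e k + e (m - k)) := by
  ext k l
  have h : (aliasMatrix m' m * Matrix.diagonal (fun j : Fin m => e j) * (aliasMatrix m' m)ᵀ) k l =
      ∑ j : Fin m, aliasMatrix m' m k j * e j * aliasMatrix m' m l j := by
    rw [Matrix.mul_apply]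
    exact Finset.sum_congr rfl fun j _ => by rw [Matrix.mul_diagonal, Matrix.transpose_apply]
  have hk := k.2
  have hl := l.2
  rw [h, Matrix.diagonal_apply]
  simp only [aliasMatrix, Matrix.of_apply]
  split_ifs with hkl
  · subst hkl
    rcases Nat.eq_zero_or_pos (k : ℕ) with h0 | h0
    · rw [Finset.sum_eq_single ⟨k, by omega⟩]
      · simp [h0, he]
      · intro j _ hj
        rw [Ne, Fin.ext_iff] at hj
        simp only at hj
        rw [if_neg hj, if_neg (by have := j.2; omega)]
        simp
      · intro h
        exact absurd (Finset.mem_univ _) h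
    · rw [← Finset.sum_subset (Finset.subset_univ
        {(⟨k, by omega⟩ : Fin m), (⟨m - k, by omega⟩ : Fin m)})]
      · rw [Finset.sum_pair (by rw [Ne, Fin.ext_iff]; simp only; omega)]
        have h1 : ¬ m - (k : ℕ) = k := by omega
        have h2 : m - (k : ℕ) + k = m := by omega
        simp [h1, h2]
      · intro j _ hj
        simp only [Finset.mem_insert, Finset.mem_singleton, Fin.ext_iff, not_or] at hj
        rw [if_neg hj.1, if_neg (by omega)]
        simp
  · rw [Fin.ext_iff] at hkl
    refine Finset.sum_eq_zero fun j _ => ?_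
    split_ifs <;> first | omega | simp

/-- The Galerkin product of a DCT-III matrix is a DCT-III matrix. -/
theorem galerkin_dctMatrix {m' m : ℕ} (hm : m = 2 * m') (g p : ℝ → ℝ) :
    cutting m' m * dctMatrix m p * dctMatrix m g * (cutting m' m * dctMatrix m p)ᴴ =
      dctMatrix m' (fun x =>
        Real.cos ((x / 2) / 2) ^ 2 * g (x / 2) * p (x / 2) ^ 2 +
        Real.cos ((Real.pi - x / 2) / 2) ^ 2 * g (Real.pi - x / 2) * p (Real.pi - x / 2) ^ 2) := by
  rcases Nat.eq_zero_or_pos m' with h0 | h0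
  · subst h0
    ext i
    exact i.elim0
  have hm'0 : (m' : ℝ) ≠ 0 := by positivity
  have hmr : (m : ℝ) = 2 * m' := by rw [hm]; push_cast; ring
  rw [prolongation_eq hm, restriction_eq hm, dctMatrix]
  have hmul : ∀ (Q' : Matrix (Fin m') (Fin m') ℂ) (F : Matrix (Fin m') (Fin m) ℂ)
      (E Q D R : Matrix (Fin m) (Fin m) ℂ) (G : Matrix (Fin m) (Fin m') ℂ)
      (R' : Matrix (Fin m') (Fin m') ℂ), R * Q = 1 →
      Q' * (F * E) * R * (Q * D * R) * (Q * (E * G) * R') = Q' * (F * (E * D * E) * G) * R' := by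
    intro Q' F E Q D R G R' h
    calc _ = Q' * (F * E) * (R * Q) * D * (R * Q) * (E * G) * R' := by
          simp only [Matrix.mul_assoc]
      _ = _ := by rw [h]; simp only [Matrix.mul_assoc, Matrix.one_mul]
  rw [hmul _ _ _ _ _ _ _ _ (dctTransform_transpose_mul_self m), Matrix.diagonal_mul_diagonal,
    Matrix.diagonal_mul_diagonal, aliasMatrix_diagonal hm (fun j => (cutSymbol m p j : ℂ) *
      (g ((j : ℝ) * Real.pi / m) : ℂ) * (cutSymbol m p j : ℂ))]
  · rw [dctMatrix]
    congr 3
    ext k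
    have e1 : (k : ℝ) * Real.pi / m' / 2 = k * Real.pi / m := by rw [hmr]; field_simp
    have e2 : Real.pi - (k : ℝ) * Real.pi / m = ((m - k : ℕ) : ℝ) * Real.pi / m := by
      have := k.2
      rw [Nat.cast_sub (by omega)]
      rw [hmr]
      field_simp
    rw [e1, e2]
    simp only [cutSymbol]
    push_cast
    ring
  · have : (m : ℝ) * Real.pi / m / 2 = Real.pi / 2 := by
      rw [hmr]; field_simp
    simp [cutSymbol, this]

theorem levelDim_eq {m₀ S : ℕ} (h : 2 ^ S ∣ m₀) : ∀ s ≤ S, m₀ = 2 ^ s * levelDim m₀ s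
  | 0, _ => by simp [levelDim]
  | s + 1, hs => by
    have ih := levelDim_eq h s (by omega)
    obtain ⟨c, hc⟩ := (pow_dvd_pow 2 hs).trans h
    have h2 : levelDim m₀ s = 2 * c := by
      have hpos : 0 < 2 ^ s := by positivity
      refine Nat.eq_of_mul_eq_mul_left hpos ?_
      rw [← ih, hc]; ring
    rw [levelDim, h2, Nat.mul_div_cancel_left _ (by norm_num), hc]

theorem levelDim_succ {m₀ S s : ℕ} (h : 2 ^ S ∣ m₀) (hs : s < S) :
    levelDim m₀ s = 2 * levelDim m₀ (s + 1) := by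
  have h1 := levelDim_eq h s hs.le
  have h2 := levelDim_eq h (s + 1) hs
  refine Nat.eq_of_mul_eq_mul_left (show 0 < 2 ^ s by positivity) ?_
  rw [← h1]
  conv_lhs => rw [h2]
  ring

theorem levelMatrix_eq_dctMatrix (f : ℝ → ℝ) (q : ℕ) {m₀ S : ℕ} (h : 2 ^ S ∣ m₀) :
    ∀ s ≤ S, levelMatrix f q m₀ s = dctMatrix (levelDim m₀ s) (levelSymbol f q m₀ s)
  | 0, _ => rfl
  | s + 1, hs => by
    rw [levelMatrix, levelMatrix_eq_dctMatrix f q h s (by omega), projector,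
      galerkin_dctMatrix (levelDim_succ h hs)]
    rfl

/-! ### Symbols as polynomials in the cosine -/

open Polynomial in
theorem IsTrigPoly.exists_polynomial {f : ℝ → ℝ} (hf : IsTrigPoly f) (heven : ∀ x, f (-x) = f x) :
    ∃ F : ℝ[X], ∀ x, f x = F.eval (Real.cos x) := by
  obtain ⟨k, a, b, h⟩ := hf
  refine ⟨∑ j ∈ Finset.range (k + 1), C (a j) * Chebyshev.T ℝ j, fun x => ?_⟩
  have h2 : f x = (f x + f (-x)) / 2 := by rw [heven]; ring
  rw [h2, h, h, ← Finset.sum_add_distrib, Finset.sum_div, eval_finsetSum]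
  refine Finset.sum_congr rfl fun j _ => ?_
  have := Chebyshev.T_real_cos x j
  simp only [Int.cast_natCast] at this
  rw [eval_mul, eval_C, this, mul_neg, Real.cos_neg, Real.sin_neg]
  ring

open Polynomial in
/-- The even part of a polynomial is a polynomial in the square of the variable, of half the
degree. -/
theorem exists_even_part (N : ℕ) : ∀ G : ℝ[X], G.natDegree ≤ N →
    ∃ H : ℝ[X], H.natDegree ≤ N / 2 ∧ ∀ c, G.eval c + G.eval (-c) = H.eval (c ^ 2) := by
  induction N using Nat.strong_induction_on with
  | _ N ih =>
    intro G hG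
    rcases Nat.lt_or_ge N 2 with hN | hN
    · -- a polynomial of degree at most one has a constant even part
      refine ⟨C (2 * G.coeff 0), (natDegree_C _).le.trans (Nat.zero_le _), fun c => ?_⟩
      have h1 : G.natDegree ≤ 1 := by omega
      rw [eq_X_add_C_of_natDegree_le_one h1]
      simp
      ring
    · have h2 : G.divX.divX.natDegree ≤ N - 2 := by
        rw [natDegree_divX_eq_natDegree_tsub_one, natDegree_divX_eq_natDegree_tsub_one]
        omega
      obtain ⟨H, hH, hev⟩ := ih (N - 2) (by omega) _ h2
      refine ⟨H * X + C (2 * G.coeff 0), ?_, fun c => ?_⟩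
      · refine (natDegree_add_le _ _).trans (max_le ?_ ((natDegree_C _).le.trans (Nat.zero_le _)))
        refine (natDegree_mul_le).trans ?_
        have := natDegree_X_le (R := ℝ)
        omega
      · have e : ∀ c, G.eval c = (G.divX.divX.eval c * c + G.divX.coeff 0) * c + G.coeff 0 := by
          intro c
          conv_lhs => rw [← divX_mul_X_add G, ← divX_mul_X_add G.divX]
          simp
        rw [eval_add, eval_mul, ← hev, e c, e (-c)]
        simp
        ring

theorem analyticOrderAt_cos_sub_one :
    analyticOrderAt (fun x : ℝ => Real.cos x - 1) 0 = 2 := by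
  have hsin : analyticOrderAt (fun x : ℝ => Real.sin (x / 2)) 0 = 1 := by
    have hd : deriv (fun x : ℝ => Real.sin (x / 2)) 0 = 1 / 2 := by simp
    have han : AnalyticAt ℝ (fun x : ℝ => Real.sin (x / 2)) 0 := by fun_prop
    have := han.analyticOrderAt_sub_eq_one_of_deriv_ne_zero (by rw [hd]; norm_num)
    simpa using this
  have han : AnalyticAt ℝ (fun x : ℝ => Real.sin (x / 2)) 0 := by fun_prop
  have heq : (fun x : ℝ => Real.cos x - 1) =
      (fun _ => (-2 : ℝ)) * (fun x : ℝ => Real.sin (x / 2)) ^ 2 := by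
    ext x
    have h1 := Real.cos_sq_add_sin_sq (x / 2)
    have h2 := Real.cos_two_mul (x / 2)
    rw [show 2 * (x / 2) = x by ring] at h2
    simp only [Pi.mul_apply, Pi.pow_apply]
    linarith
  have hc : analyticOrderAt (fun _ : ℝ => (-2 : ℝ)) (0 : ℝ) = 0 :=
    analyticAt_const.analyticOrderAt_eq_zero.2 (by norm_num)
  rw [heq, analyticOrderAt_mul analyticAt_const (han.pow 2), analyticOrderAt_pow han, hsin, hc]
  rfl

open Polynomial in
/-- A nonnegative symbol that vanishes on `2πℤ` only, to the order `2q`, is comparable with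
`(1 - cos x)^q`. -/
theorem symbol_comparable {f : ℝ → ℝ} {q : ℕ} (hnonneg : ∀ x, 0 ≤ f x)
    (hzero : ∀ x, f x = 0 ↔ ∃ k : ℤ, x = 2 * Real.pi * k)
    (hord : analyticOrderAt f 0 = ((2 * q : ℕ) : ℕ∞)) {F : ℝ[X]}
    (hF : ∀ x, f x = F.eval (Real.cos x)) :
    ∃ a b : ℝ, 0 < a ∧ 0 < b ∧ ∀ t ∈ Set.Icc (-1 : ℝ) 1,
      a * (1 - t) ^ q ≤ F.eval t ∧ F.eval t ≤ b * (1 - t) ^ q := by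
  have hF' : ∀ t ∈ Set.Icc (-1 : ℝ) 1, F.eval t = f (Real.arccos t) := fun t ht => by
    rw [hF, Real.cos_arccos ht.1 ht.2]
  have hFne : ∀ t ∈ Set.Ico (-1 : ℝ) 1, F.eval t ≠ 0 := by
    intro t ht h0
    rw [hF' t ⟨ht.1, ht.2.le⟩, hzero] at h0
    obtain ⟨k, hk⟩ := h0
    have h1 : Real.cos (Real.arccos t) = 1 := by
      rw [hk, mul_comm]
      exact Real.cos_int_mul_two_pi k
    rw [Real.cos_arccos ht.1 ht.2.le] at h1
    exact ht.2.ne h1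
  have hF0 : F ≠ 0 := fun h => hFne 0 (by norm_num) (by rw [h]; simp)
  obtain ⟨G, hG, hdvd⟩ := exists_eq_pow_rootMultiplicity_mul_and_not_dvd F hF0 1
  have hG1 : G.eval 1 ≠ 0 := fun h => hdvd (dvd_iff_isRoot.2 h)
  have hr : rootMultiplicity 1 F = q := by
    have hGan : AnalyticAt ℝ (fun x : ℝ => G.eval (Real.cos x)) 0 := by
      have : AnalyticAt ℝ (fun x : ℝ => aeval (Real.cos x) G) 0 :=
        Real.analyticAt_cos.aeval_polynomial G
      simpa using this
    have hfe : f = (fun x : ℝ => Real.cos x - 1) ^ (rootMultiplicity 1 F) *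
        (fun x : ℝ => G.eval (Real.cos x)) := by
      ext x
      rw [hF]
      conv_lhs => rw [hG]
      simp
    have hcan : AnalyticAt ℝ (fun x : ℝ => Real.cos x - 1) 0 := by fun_prop
    rw [hfe, analyticOrderAt_mul (hcan.pow _) hGan, analyticOrderAt_pow hcan,
      analyticOrderAt_cos_sub_one, hGan.analyticOrderAt_eq_zero.2 (by simpa using hG1), add_zero,
      nsmul_eq_mul] at hord
    have : rootMultiplicity 1 F * 2 = 2 * q := by exact_mod_cast hord
    omega
  have hFG : ∀ t ∈ Set.Icc (-1 : ℝ) 1, F.eval t = |G.eval t| * (1 - t) ^ q := by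
    intro t ht
    have h0 : 0 ≤ F.eval t := by rw [hF' t ht]; exact hnonneg _
    rw [← abs_of_nonneg h0]
    conv_lhs => rw [hG]
    rw [hr, eval_mul, abs_mul, eval_pow, abs_pow, eval_sub, eval_X, eval_C, abs_sub_comm,
      abs_of_nonneg (by linarith [ht.2] : (0 : ℝ) ≤ 1 - t), mul_comm]
  have hGpos : ∀ t ∈ Set.Icc (-1 : ℝ) 1, 0 < |G.eval t| := by
    intro t ht
    rw [abs_pos]
    rcases eq_or_lt_of_le ht.2 with h | h
    · rw [h]; exact hG1
    · intro h0
      have := hFG t ht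
      rw [h0] at this
      simp at this
      exact hFne t ⟨ht.1, h⟩ this
  have hcont : ContinuousOn (fun t => |G.eval t|) (Set.Icc (-1 : ℝ) 1) :=
    (G.continuous.abs).continuousOn
  have hne : (Set.Icc (-1 : ℝ) 1).Nonempty := ⟨0, by norm_num⟩
  obtain ⟨t₁, ht₁, hmin⟩ := isCompact_Icc.exists_isMinOn hne hcont
  obtain ⟨t₂, ht₂, hmax⟩ := isCompact_Icc.exists_isMaxOn hne hcont
  refine ⟨|G.eval t₁|, |G.eval t₂|, hGpos _ ht₁, hGpos _ ht₂, fun t ht => ?_⟩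
  have hp : 0 ≤ (1 - t) ^ q := pow_nonneg (by linarith [ht.2]) q
  rw [hFG t ht]
  exact ⟨mul_le_mul_of_nonneg_right (hmin ht) hp, mul_le_mul_of_nonneg_right (hmax ht) hp⟩

/-! ### Uniform bounds for the symbols of all levels -/

/-- The weight `(sin (x/2) / (x/2))^{2(q+1)}`; it is invariant under the dominant term of the
recursion for the symbols, and bounded below on `[0, π]`. -/
noncomputable def sincWeight (q : ℕ) (x : ℝ) : ℝ := Real.sinc (x / 2) ^ (2 * (q + 1))

theorem sincWeight_half (q : ℕ) (y : ℝ) :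
    sincWeight q (2 * y) = ((1 + Real.cos y) / 2) ^ (q + 1) * sincWeight q y := by
  have h : Real.sinc y = Real.cos (y / 2) * Real.sinc (y / 2) := by
    by_cases hy : y = 0
    · simp [hy]
    · rw [Real.sinc_of_ne_zero hy, Real.sinc_of_ne_zero (by simpa using hy)]
      have := Real.sin_two_mul (y / 2)
      rw [show 2 * (y / 2) = y by ring] at this
      rw [this]
      field_simp
  have hc : (1 + Real.cos y) / 2 = Real.cos (y / 2) ^ 2 := by
    have := Real.cos_two_mul (y / 2)
    rw [show 2 * (y / 2) = y by ring] at this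
    rw [this]; ring
  rw [sincWeight, sincWeight, show 2 * y / 2 = y by ring, h, mul_pow, hc, ← pow_mul]

theorem sincWeight_nonneg (q : ℕ) (x : ℝ) : 0 ≤ sincWeight q x := by
  rw [sincWeight, pow_mul]; positivity

theorem sincWeight_le_one (q : ℕ) (x : ℝ) : sincWeight q x ≤ 1 := by
  rw [sincWeight, pow_mul]
  exact pow_le_one₀ (sq_nonneg _) ((sq_le_one_iff_abs_le_one _).2
    (abs_le.2 ⟨Real.neg_one_le_sinc _, Real.sinc_le_one _⟩))

theorem le_sincWeight (q : ℕ) {x : ℝ} (h0 : 0 ≤ x) (hpi : x ≤ Real.pi) :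
    (2 / Real.pi) ^ (2 * (q + 1)) ≤ sincWeight q x := by
  refine pow_le_pow_left₀ (by positivity) ?_ _
  rcases h0.eq_or_lt with h | h
  · rw [← h]
    simp
    rw [div_le_one Real.pi_pos]
    exact Real.two_le_pi
  · rw [Real.sinc_of_ne_zero (by positivity), le_div_iff₀ (by positivity)]
    exact Real.mul_le_sin (by positivity) (by linarith)

theorem indicator_two_pi_int (x : ℝ) :
    Set.indicator {y : ℝ | ∃ k : ℤ, y = 2 * Real.pi * k} (fun _ => (1 : ℝ)) x =
      if Real.cos x = 1 then 1 else 0 := by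
  have h : x ∈ {y : ℝ | ∃ k : ℤ, y = 2 * Real.pi * k} ↔ Real.cos x = 1 := by
    rw [Real.cos_eq_one_iff]
    exact exists_congr fun k => by rw [eq_comm, mul_comm]
  by_cases hx : Real.cos x = 1
  · rw [if_pos hx, Set.indicator_of_mem (h.2 hx)]
  · rw [if_neg hx, Set.indicator_of_notMem (fun h' => hx (h.1 h'))]

open Polynomial in
/-- The symbols of all levels are polynomials of bounded degree in the cosine, up to the Strang
correction at the zero, and are uniformly comparable with `(1 - cos x)^q`. -/
theorem levelSymbol_form {f : ℝ → ℝ} {q : ℕ} {F : ℝ[X]} (hF : ∀ x, f x = F.eval (Real.cos x))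
    {a b : ℝ} (ha : 0 < a) (hb : 0 < b)
    (hab : ∀ t ∈ Set.Icc (-1 : ℝ) 1, a * (1 - t) ^ q ≤ F.eval t ∧ F.eval t ≤ b * (1 - t) ^ q)
    (m₀ s : ℕ) : ∃ G : ℝ[X], G.natDegree ≤ max F.natDegree (2 * q + 1) ∧
      (∀ x, levelSymbol f q m₀ s x = G.eval (Real.cos x) +
        4 ^ (q * s) * f (Real.pi / m₀) * if Real.cos x = 1 then 1 else 0) ∧
      (∀ t ∈ Set.Icc (-1 : ℝ) 1, G.eval t ≤ b * (1 - t) ^ q) ∧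
      ∀ x ∈ Set.Icc 0 Real.pi, a * sincWeight q x * (1 - Real.cos x) ^ q ≤ G.eval (Real.cos x) := by
  induction s with
  | zero =>
    refine ⟨F, le_max_left _ _, fun x => ?_, fun t ht => (hab t ht).2, fun x _ => ?_⟩
    · rw [levelSymbol, strangSymbol, hF x, indicator_two_pi_int]
      simp
    · have h1 := (hab (Real.cos x) ⟨Real.neg_one_le_cos x, Real.cos_le_one x⟩).1
      refine le_trans ?_ h1
      have hp : 0 ≤ (1 - Real.cos x) ^ q := pow_nonneg (by linarith [Real.cos_le_one x]) q
      refine mul_le_mul_of_nonneg_right ?_ hp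
      exact mul_le_of_le_one_right ha.le (sincWeight_le_one q x)
  | succ s ih =>
    obtain ⟨G, hdeg, hform, hup, hlow⟩ := ih
    -- the even part of `(1 + c)^{2q+1} G(c) / 2` in `c = cos (x / 2)`
    obtain ⟨H, hHdeg, hH⟩ := exists_even_part (G.natDegree + (2 * q + 1))
      (C (1 / 2) * (1 + X) ^ (2 * q + 1) * G) (by
        refine natDegree_mul_le.trans ?_
        rw [add_comm]
        refine Nat.add_le_add_left ((natDegree_C_mul_le _ _).trans ?_) _
        refine natDegree_pow_le.trans ?_
        have : (1 + X : ℝ[X]).natDegree ≤ 1 :=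
          (natDegree_add_le _ _).trans (max_le (by simp) natDegree_X_le)
        nlinarith)
    have hval : ∀ c, (H.comp (C (1 / 2) * (X + 1))).eval (2 * c ^ 2 - 1) =
        (1 + c) / 2 * G.eval c * ((1 + c) ^ q) ^ 2 +
          (1 - c) / 2 * G.eval (-c) * ((1 - c) ^ q) ^ 2 := by
      intro c
      have h1 := hH c
      rw [eval_comp]
      simp only [eval_mul, eval_C, eval_add, eval_X, eval_one, eval_pow] at h1 ⊢
      rw [show 1 / 2 * (2 * c ^ 2 - 1 + 1) = c ^ 2 by ring, ← h1]
      ring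
    have htwo : ∀ x, Real.cos x = 2 * Real.cos (x / 2) ^ 2 - 1 := fun x => by
      rw [← Real.cos_two_mul]; congr 1; ring
    have hcos2 : ∀ y, Real.cos (y / 2) ^ 2 = (1 + Real.cos y) / 2 := fun y => by
      rw [htwo y]; ring
    refine ⟨H.comp (C (1 / 2) * (X + 1)), ?_, fun x => ?_, fun t ht => ?_, fun x hx => ?_⟩
    · refine natDegree_comp_le.trans ?_
      have h1 : (C (1 / 2) * (X + 1) : ℝ[X]).natDegree ≤ 1 :=
        (natDegree_C_mul_le _ _).trans ((natDegree_add_le _ _).trans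
          (max_le natDegree_X_le (by simp)))
      have h2 : H.natDegree ≤ max F.natDegree (2 * q + 1) := by
        have := le_max_right F.natDegree (2 * q + 1)
        omega
      nlinarith
    · simp only [levelSymbol]
      rw [hform, hform, hcos2, hcos2, Real.cos_pi_sub, projPoly, projPoly,
        Real.cos_pi_sub, htwo x, hval]
      have hk : q * (s + 1) = q + q * s := by ring
      have h4 : ((2 : ℝ) ^ q) ^ 2 = 4 ^ q := by rw [← pow_mul, mul_comm, pow_mul]; norm_num
      rw [hk, pow_add]
      set c := Real.cos (x / 2)
      by_cases h1 : c = 1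
      · rw [h1]
        norm_num
        rw [h4]
        ring
      by_cases h2 : c = -1
      · rw [h2]
        norm_num
        rw [h4]
        ring
      have h3 : ¬ (-c = 1) := fun h => h2 (by linarith)
      have h5 : ¬ (2 * c ^ 2 - 1 = 1) := by
        intro h
        have : (c - 1) * (c + 1) = 0 := by linear_combination h / 2
        rcases mul_eq_zero.1 this with h | h
        · exact h1 (by linarith)
        · exact h2 (by linarith)
      rw [if_neg h1, if_neg h3, if_neg h5]
      ring
    · -- substitute `t = 2 c² - 1` with `c ∈ [0, 1]`; the two weights `u^{q+1}`, `(1-u)^{q+1}` with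
      -- `u = (1 + c) / 2` add up to at most `1`
      set c := Real.sqrt ((1 + t) / 2) with hc
      have hcsq : c ^ 2 = (1 + t) / 2 := Real.sq_sqrt (by linarith [ht.1])
      have hc0 : 0 ≤ c := Real.sqrt_nonneg _
      have hc1 : c ≤ 1 := by
        by_contra h
        have := ht.2
        nlinarith
      have htc : t = 2 * c ^ 2 - 1 := by rw [hcsq]; ring
      rw [htc, hval]
      have hu := hup c ⟨by linarith, hc1⟩
      have hv := hup (-c) ⟨by linarith, by linarith⟩
      rw [sub_neg_eq_add] at hv
      have hA : 0 ≤ (1 + c) ^ q := pow_nonneg (by linarith) q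
      have hB : 0 ≤ (1 - c) ^ q := pow_nonneg (by linarith) q
      have hA2 : (1 + c) ^ q ≤ 2 ^ q := pow_le_pow_left₀ (by linarith) (by linarith) q
      have hB2 : (1 - c) ^ q ≤ 2 ^ q := pow_le_pow_left₀ (by linarith) (by linarith) q
      have hR : (1 - (2 * c ^ 2 - 1)) ^ q = 2 ^ q * (1 + c) ^ q * (1 - c) ^ q := by
        rw [← mul_pow, ← mul_pow]; congr 1; ring
      rw [hR]
      calc _ ≤ (1 + c) / 2 * (b * (1 - c) ^ q) * ((1 + c) ^ q) ^ 2 +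
            (1 - c) / 2 * (b * (1 + c) ^ q) * ((1 - c) ^ q) ^ 2 := by
            have h1c : (0 : ℝ) ≤ (1 + c) / 2 := by linarith
            have h1c' : (0 : ℝ) ≤ (1 - c) / 2 := by linarith
            gcongr
        _ = b * ((1 + c) ^ q * (1 - c) ^ q) *
            ((1 + c) / 2 * (1 + c) ^ q + (1 - c) / 2 * (1 - c) ^ q) := by ring
        _ ≤ b * ((1 + c) ^ q * (1 - c) ^ q) *
            ((1 + c) / 2 * 2 ^ q + (1 - c) / 2 * 2 ^ q) := by
            have h1c : (0 : ℝ) ≤ (1 + c) / 2 := by linarith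
            have h1c' : (0 : ℝ) ≤ (1 - c) / 2 := by linarith
            gcongr
        _ = _ := by ring
    · set y := x / 2 with hy
      have hx2 : x = 2 * y := by rw [hy]; ring
      have hy0 : 0 ≤ y := by have := hx.1; positivity
      have hypi : y ≤ Real.pi / 2 := by have := hx.2; linarith
      have hpi := Real.pi_pos
      have hl1 := hlow y ⟨hy0, by linarith⟩
      have hl2 := hlow (Real.pi - y) ⟨by linarith, by linarith⟩
      rw [Real.cos_pi_sub] at hl2
      have hc1 := Real.cos_le_one y
      have hc0 := Real.neg_one_le_cos y
      rw [hx2, sincWeight_half, Real.cos_two_mul, hval]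
      set c := Real.cos y
      have hR : (1 - (2 * c ^ 2 - 1)) ^ q = 2 ^ q * (1 + c) ^ q * (1 - c) ^ q := by
        rw [← mul_pow, ← mul_pow]; congr 1; ring
      have hA : 0 ≤ (1 + c) ^ q := pow_nonneg (by linarith) q
      have hB : 0 ≤ (1 - c) ^ q := pow_nonneg (by linarith) q
      have hw := sincWeight_nonneg q y
      have hG2 : 0 ≤ G.eval (-c) := by
        refine le_trans ?_ hl2
        have := sincWeight_nonneg q (Real.pi - y)
        rw [sub_neg_eq_add]
        positivity
      have h1c : (0 : ℝ) ≤ (1 + c) / 2 := by linarith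
      have h1c' : (0 : ℝ) ≤ (1 - c) / 2 := by linarith
      rw [hR]
      calc _ = (1 + c) / 2 * (a * sincWeight q y * (1 - c) ^ q) * ((1 + c) ^ q) ^ 2 := by
            rw [pow_succ, div_pow]
            field_simp
        _ ≤ (1 + c) / 2 * G.eval c * ((1 + c) ^ q) ^ 2 := by gcongr
        _ ≤ _ := le_add_of_nonneg_right (by positivity)

/-! ### Energy, smoothing and approximation -/

/-- The squared energy norm. -/
noncomputable def energy {m : ℕ} (A : Matrix (Fin m) (Fin m) ℂ) (v : Fin m → ℂ) : ℝ :=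
  (star v ⬝ᵥ (A *ᵥ v)).re

/-- The squared Euclidean norm. -/
noncomputable def sqNorm {m : ℕ} (v : Fin m → ℂ) : ℝ := (star v ⬝ᵥ v).re

theorem sqNorm_eq_sum {m : ℕ} (v : Fin m → ℂ) :
    sqNorm v = ∑ j, ‖v j‖ ^ 2 := by
  simp only [sqNorm, dotProduct, Complex.re_sum, Pi.star_apply, RCLike.star_def]
  refine Finset.sum_congr rfl fun j _ => ?_
  rw [← Complex.normSq_eq_conj_mul_self, Complex.ofReal_re, Complex.normSq_eq_norm_sq]

theorem energy_cosMatrix {m : ℕ} (d : Fin m → ℝ) (v : Fin m → ℂ) :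
    energy (cosMatrix m fun j => (d j : ℂ)) v = ∑ j, d j * ‖coeff v j‖ ^ 2 := by
  rw [energy, star_dotProduct_eq_coeff]
  simp only [dotProduct, Complex.re_sum, Pi.star_apply, RCLike.star_def]
  refine Finset.sum_congr rfl fun j _ => ?_
  rw [coeff_cosMatrix_mulVec, mul_left_comm, ← Complex.normSq_eq_conj_mul_self,
    ← Complex.ofReal_mul, Complex.ofReal_re, Complex.normSq_eq_norm_sq]

theorem sqNorm_cosMatrix_mulVec {m : ℕ} (d : Fin m → ℝ) (v : Fin m → ℂ) :
    sqNorm (cosMatrix m (fun j => (d j : ℂ)) *ᵥ v) = ∑ j, d j ^ 2 * ‖coeff v j‖ ^ 2 := by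
  rw [sqNorm, star_dotProduct_eq_coeff, ← sqNorm, sqNorm_eq_sum]
  refine Finset.sum_congr rfl fun j _ => ?_
  rw [coeff_cosMatrix_mulVec, norm_mul, mul_pow, Complex.norm_real, Real.norm_eq_abs, sq_abs]

theorem coeff_richardson_iterate {m : ℕ} (d : Fin m → ℝ) (ω : ℝ) {b x : Fin m → ℂ}
    (hb : cosMatrix m (fun j => (d j : ℂ)) *ᵥ x = b) (n : ℕ) (y : Fin m → ℂ) (j : Fin m) :
    coeff ((richardson (cosMatrix m fun j => (d j : ℂ)) ω b)^[n] y - x) j =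
      ((1 - ω * d j : ℝ) : ℂ) ^ n * coeff (y - x) j := by
  induction n with
  | zero => simp
  | succ n ih =>
    rw [Function.iterate_succ_apply', pow_succ', mul_assoc, ← ih]
    set z := (richardson (cosMatrix m fun j => (d j : ℂ)) ω b)^[n] y
    have h : richardson (cosMatrix m fun j => (d j : ℂ)) ω b z - x =
        (z - x) - (ω : ℂ) • (cosMatrix m (fun j => (d j : ℂ)) *ᵥ (z - x)) := by
      rw [richardson, ← hb, Matrix.mulVec_sub]
      abel
    rw [h, coeff_sub, coeff_smul, Pi.sub_apply, Pi.smul_apply, coeff_cosMatrix_mulVec]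
    push_cast
    rw [smul_eq_mul]
    ring

theorem energy_richardson_iterate_le {m : ℕ} {d : Fin m → ℝ} (hd : ∀ j, 0 < d j) {M θ : ℝ}
    (hM : 0 < M) (hdM : ∀ j, d j ≤ M) (hθ : 0 < θ ∧ θ ≤ 2) {b x : Fin m → ℂ}
    (hb : cosMatrix m (fun j => (d j : ℂ)) *ᵥ x = b) (n : ℕ) (y : Fin m → ℂ) :
    energy (cosMatrix m fun j => (d j : ℂ))
      ((richardson (cosMatrix m fun j => (d j : ℂ)) (θ / M) b)^[n] y - x) ≤
      energy (cosMatrix m fun j => (d j : ℂ)) (y - x) := by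
  rw [energy_cosMatrix, energy_cosMatrix]
  refine Finset.sum_le_sum fun j _ => ?_
  rw [coeff_richardson_iterate d _ hb, norm_mul, norm_pow, Complex.norm_real, Real.norm_eq_abs]
  refine mul_le_mul_of_nonneg_left ?_ (hd j).le
  refine pow_le_pow_left₀ (by positivity) ?_ 2
  refine mul_le_of_le_one_left (norm_nonneg _) (pow_le_one₀ (abs_nonneg _) ?_)
  have h1 : 0 ≤ θ / M * d j := by have := hd j; have := hθ.1; positivity
  have h2 : θ / M * d j ≤ 2 := by
    rw [div_mul_eq_mul_div, div_le_iff₀ hM]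
    have := hdM j
    have := hd j
    nlinarith [hθ.1, hθ.2]
  rw [abs_le]
  constructor <;> linarith

/-- The smoothing property of the Richardson sweeps. -/
theorem energy_richardson_iterate_le_sub {m : ℕ} {d : Fin m → ℝ} (hd : ∀ j, 0 < d j) {M : ℝ}
    (hM : 0 < M) (hdM : ∀ j, d j ≤ M) {b x : Fin m → ℂ}
    (hb : cosMatrix m (fun j => (d j : ℂ)) *ᵥ x = b) {n : ℕ} (hn : 1 ≤ n) (y : Fin m → ℂ) :
    energy (cosMatrix m fun j => (d j : ℂ))
      ((richardson (cosMatrix m fun j => (d j : ℂ)) (1 / M) b)^[n] y - x) ≤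
      energy (cosMatrix m fun j => (d j : ℂ)) (y - x) -
        sqNorm (cosMatrix m (fun j => (d j : ℂ)) *ᵥ (y - x)) / M := by
  rw [energy_cosMatrix, energy_cosMatrix, sqNorm_cosMatrix_mulVec, Finset.sum_div,
    ← Finset.sum_sub_distrib]
  refine Finset.sum_le_sum fun j _ => ?_
  rw [coeff_richardson_iterate d _ hb, norm_mul, norm_pow, Complex.norm_real, Real.norm_eq_abs]
  have hdj := hd j
  set t := d j / M with ht
  have ht0 : 0 < t := by positivity
  have ht1 : t ≤ 1 := (div_le_one hM).2 (hdM j)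
  have hdt : d j = t * M := by rw [ht]; field_simp
  rw [show 1 / M * d j = t by rw [ht]; ring]
  have h1 : |1 - t| ^ n ≤ 1 - t := by
    rw [abs_of_nonneg (by linarith)]
    exact pow_le_of_le_one (by linarith) (by linarith) (by omega)
  have h2 : (|1 - t| ^ n) ^ 2 ≤ 1 - t := by
    have := pow_nonneg (abs_nonneg (1 - t)) n
    nlinarith
  set N := ‖coeff (y - x) j‖ ^ 2
  have hN : 0 ≤ N := sq_nonneg _
  rw [mul_pow]
  have e : d j * N - d j ^ 2 * N / M = d j * ((1 - t) * N) := by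
    rw [hdt]; field_simp
  rw [e]
  gcongr

/-- The strong approximation property: the coarse grid function that matches the low frequencies of
`u`, weighted by the restriction symbol, approximates `u` up to `‖A u‖`. -/
theorem exists_coarse_approximation {m' m : ℕ} (hm : m = 2 * m') (p : ℝ → ℝ) {d : ℕ → ℝ}
    (hd : ∀ j < m, 0 < d j) {lo hi : ℝ} (hlo : 0 < lo)
    (hhigh : ∀ j, m' ≤ j → j < m → lo ≤ d j ∧ d j ≤ hi)
    (hcut : ∀ k < m', cutSymbol m p k ≠ 0)
    (halias : ∀ k, 0 < k → k < m' →
      cutSymbol m p (m - k) ^ 2 * lo ^ 2 ≤ d k ^ 2 * cutSymbol m p k ^ 2) (u : Fin m → ℂ) :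
    ∃ w : Fin m' → ℂ, energy (cosMatrix m fun j => ((d j : ℝ) : ℂ))
        (u - (cutting m' m * dctMatrix m p)ᴴ *ᵥ w) ≤
      4 * (1 / lo + hi / lo ^ 2) * sqNorm (cosMatrix m (fun j => ((d j : ℝ) : ℂ)) *ᵥ u) := by
  rcases Nat.eq_zero_or_pos m' with h0 | h0
  · refine ⟨0, ?_⟩
    have : m = 0 := by omega
    subst this
    simp [energy, sqNorm]
  have hm0 : NeZero m := ⟨by omega⟩
  have hhi : 0 < hi := by
    have := hhigh m' le_rfl (by omega)
    linarith [this.1, this.2]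
  set ŵ : Fin m' → ℂ := fun k => coeff u ⟨k, by omega⟩ / cutSymbol m p k with hŵ
  refine ⟨dctTransform m' *ᵥ ŵ, ?_⟩
  rw [energy_cosMatrix, sqNorm_cosMatrix_mulVec]
  set γ := 1 / lo + hi / lo ^ 2 with hγ
  have hγ1 : 1 / lo ≤ γ := le_add_of_nonneg_right (by positivity)
  have hγ2 : hi / lo ^ 2 ≤ γ := le_add_of_nonneg_left (by positivity)
  have hγ0 : 0 ≤ γ := le_trans (by positivity) hγ1
  -- the frequency `m - j` of a high frequency `j` is `-j` in `Fin m`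
  set g : Fin m → ℝ := fun j => d j ^ 2 * ‖coeff u j‖ ^ 2 with hg
  have hg0 : ∀ j, 0 ≤ g j := fun j => by rw [hg]; positivity
  have hsum : ∑ j, g (-j) = ∑ j, g j := Equiv.sum_comp (Equiv.neg (Fin m)) g
  have hbound : ∀ j : Fin m, d j * ‖coeff (u - (cutting m' m * dctMatrix m p)ᴴ *ᵥ
      (dctTransform m' *ᵥ ŵ)) j‖ ^ 2 ≤ 2 * γ * (g j + g (-j)) := by
    intro j
    have hj := j.2
    have hRnonneg : 0 ≤ 2 * γ * (g j + g (-j)) := by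
      have := hg0 j
      have := hg0 (-j)
      positivity
    rw [coeff_sub, Pi.sub_apply, coeff_prolongation hm, coeff_dctTransform_mulVec]
    by_cases h1 : (j : ℕ) < m'
    · rw [dif_pos h1]
      have : coeff u j - cutSymbol m p j * ŵ ⟨j, h1⟩ = 0 := by
        have hc : (cutSymbol m p j : ℂ) ≠ 0 := Complex.ofReal_ne_zero.2 (hcut j h1)
        simp only [hŵ]
        rw [mul_div_cancel₀ _ hc, sub_self]
      rw [this]
      simpa using hRnonneg
    rw [dif_neg h1]
    obtain ⟨hl, hh⟩ := hhigh j (by omega) hj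
    have hdj := hd j hj
    have hlow : d j ≤ γ * d j ^ 2 := by
      have : 1 ≤ 1 / lo * d j := by rw [one_div_mul_eq_div, one_le_div hlo]; exact hl
      have h3 : 1 / lo * d j ≤ γ * d j := by gcongr
      nlinarith
    by_cases h2 : m' < (j : ℕ)
    · rw [dif_pos h2]
      set k : ℕ := m - j with hk
      have hneg : ((-j : Fin m) : ℕ) = k := by
        rw [Fin.val_neg', Nat.mod_eq_of_lt (by omega)]
      have hkm : k < m' := by omega
      have hjk : (j : ℕ) = m - k := by omega
      have hnegj : (-j : Fin m) = ⟨k, by omega⟩ := Fin.ext hneg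
      set U := coeff u ⟨k, by omega⟩ with hU
      have hgk : g (-j) = d k ^ 2 * ‖U‖ ^ 2 := by simp only [hg, hnegj, hU]
      have hc := hcut k hkm
      have hal := halias k (by omega) hkm
      rw [← hjk] at hal
      have hval : coeff u j - cutSymbol m p j * -ŵ ⟨k, by omega⟩ =
          coeff u j + ((cutSymbol m p j / cutSymbol m p k : ℝ) : ℂ) * U := by
        simp only [hŵ, hU]
        push_cast
        ring
      rw [hval]
      have hratio : (cutSymbol m p j / cutSymbol m p k) ^ 2 ≤ d k ^ 2 / lo ^ 2 := by
        rw [div_pow, div_le_div_iff₀ (by positivity) (by positivity)]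
        exact hal
      have hnorm : ‖coeff u j + ((cutSymbol m p j / cutSymbol m p k : ℝ) : ℂ) * U‖ ^ 2 ≤
          2 * (‖coeff u j‖ ^ 2 + d k ^ 2 / lo ^ 2 * ‖U‖ ^ 2) := by
        have h3 := norm_add_le (coeff u j) (((cutSymbol m p j / cutSymbol m p k : ℝ) : ℂ) * U)
        have h4 : ‖((cutSymbol m p j / cutSymbol m p k : ℝ) : ℂ) * U‖ ^ 2 ≤
            d k ^ 2 / lo ^ 2 * ‖U‖ ^ 2 := by
          rw [norm_mul, mul_pow, Complex.norm_real, Real.norm_eq_abs, sq_abs]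
          gcongr
        have h5 := sq_nonneg (‖coeff u j‖ -
          ‖((cutSymbol m p j / cutSymbol m p k : ℝ) : ℂ) * U‖)
        have h6 := pow_le_pow_left₀ (norm_nonneg _) h3 2
        nlinarith
      calc _ ≤ d j * (2 * (‖coeff u j‖ ^ 2 + d k ^ 2 / lo ^ 2 * ‖U‖ ^ 2)) := by gcongr
        _ = 2 * (d j * ‖coeff u j‖ ^ 2 + (d j / lo ^ 2) * (d k ^ 2 * ‖U‖ ^ 2)) := by ring
        _ ≤ 2 * ((γ * d j ^ 2) * ‖coeff u j‖ ^ 2 + γ * (d k ^ 2 * ‖U‖ ^ 2)) := by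
          have : d j / lo ^ 2 ≤ γ := le_trans (by gcongr) hγ2
          gcongr
        _ = _ := by rw [hgk, hg]; ring
    · rw [dif_neg h2, mul_zero, sub_zero]
      have h3 := hg0 (-j)
      have h4 := hg0 j
      calc _ ≤ γ * d j ^ 2 * ‖coeff u j‖ ^ 2 := by gcongr
        _ = γ * g j := by rw [hg]; ring
        _ ≤ _ := by nlinarith [mul_nonneg hγ0 h3, mul_nonneg hγ0 h4]
  calc _ ≤ ∑ j, 2 * γ * (g j + g (-j)) := Finset.sum_le_sum fun j _ => hbound j
    _ = 4 * γ * ∑ j, g j := by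
      rw [← Finset.mul_sum, Finset.sum_add_distrib, hsum]; ring

/-! ### Convergence of the V-cycle -/

theorem energy_nonneg {m : ℕ} {A : Matrix (Fin m) (Fin m) ℂ} (hA : A.PosDef) (v : Fin m → ℂ) :
    0 ≤ energy A v :=
  (Complex.le_def.1 (hA.posSemidef.dotProduct_mulVec_nonneg v)).1

/-- Pythagoras' identity for the Galerkin coarse grid correction. -/
theorem energy_add_prolongation {m m' : ℕ} {A : Matrix (Fin m) (Fin m) ℂ} (hA : A.IsHermitian)
    (P : Matrix (Fin m') (Fin m) ℂ) {e : Fin m → ℂ} (he : P *ᵥ (A *ᵥ e) = 0) (z : Fin m' → ℂ) :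
    energy A (e + Pᴴ *ᵥ z) = energy A e + energy (P * A * Pᴴ) z := by
  have hadj : ∀ x, star (Pᴴ *ᵥ z) ⬝ᵥ x = star z ⬝ᵥ (P *ᵥ x) := fun x => by
    rw [Matrix.star_mulVec, Matrix.conjTranspose_conjTranspose, ← Matrix.dotProduct_mulVec]
  have h1 : star (Pᴴ *ᵥ z) ⬝ᵥ (A *ᵥ e) = 0 := by rw [hadj, he, dotProduct_zero]
  have h2 : star e ⬝ᵥ (A *ᵥ (Pᴴ *ᵥ z)) = 0 := by
    have h3 : star e ⬝ᵥ (A *ᵥ (Pᴴ *ᵥ z)) = star (star (Pᴴ *ᵥ z) ⬝ᵥ (A *ᵥ e)) := by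
      rw [← Matrix.star_dotProduct, Matrix.star_mulVec, hA.eq, ← Matrix.dotProduct_mulVec]
    rw [h3, h1, star_zero]
  simp only [energy]
  rw [Matrix.mulVec_add, star_add, add_dotProduct, dotProduct_add, dotProduct_add, h1, h2, hadj,
    Matrix.mulVec_mulVec, Matrix.mulVec_mulVec]
  simp [Matrix.mul_assoc]

/-- One level of the V-cycle analysis. The coarse grid error is reduced by the recursive call, and
the `A`-orthogonal complement of the coarse space by the post-smoother, since the smoother gains
`‖A u‖² / M`, which the approximation property bounds below. -/
theorem energy_coarse_correction_le {m m' : ℕ} {A : Matrix (Fin m) (Fin m) ℂ} (hA : A.PosDef)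
    {P : Matrix (Fin m') (Fin m) ℂ} (hAc : (P * A * Pᴴ).PosDef) {M γ κ : ℝ} (hM : 0 < M)
    (hγ : 0 < γ) (hκ : M * γ ≤ κ)
    (happrox : ∀ u, ∃ w, energy A (u - Pᴴ *ᵥ w) ≤ γ * sqNorm (A *ᵥ u))
    {e e' : Fin m → ℂ} {y y' : Fin m' → ℂ} (hy' : (P * A * Pᴴ) *ᵥ y' = P *ᵥ (A *ᵥ e))
    (hy : energy (P * A * Pᴴ) (y - y') ≤ (1 - 1 / κ) * energy (P * A * Pᴴ) y')
    (he' : energy A e' ≤ energy A (e - Pᴴ *ᵥ y) - sqNorm (A *ᵥ (e - Pᴴ *ᵥ y)) / M) :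
    energy A e' ≤ (1 - 1 / κ) * energy A e := by
  set e₂ := e - Pᴴ *ᵥ y' with he₂
  have horth : P *ᵥ (A *ᵥ e₂) = 0 := by
    rw [he₂, Matrix.mulVec_sub, Matrix.mulVec_sub, ← hy', Matrix.mulVec_mulVec,
      Matrix.mulVec_mulVec, sub_self]
  have hpyth := energy_add_prolongation hA.1 P horth
  have h1 : energy A e = energy A e₂ + energy (P * A * Pᴴ) y' := by
    rw [← hpyth, he₂, sub_add_cancel]
  have hu : e - Pᴴ *ᵥ y = e₂ + Pᴴ *ᵥ (y' - y) := by
    rw [he₂, Matrix.mulVec_sub]; abel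
  have hsymm : energy (P * A * Pᴴ) (y' - y) = energy (P * A * Pᴴ) (y - y') := by
    rw [← neg_sub y y', energy, energy, Matrix.mulVec_neg, star_neg, neg_dotProduct_neg]
  have h2 : energy A (e - Pᴴ *ᵥ y) = energy A e₂ + energy (P * A * Pᴴ) (y - y') := by
    rw [hu, hpyth, hsymm]
  obtain ⟨w, hw⟩ := happrox (e - Pᴴ *ᵥ y)
  have h3 : energy A e₂ ≤ γ * sqNorm (A *ᵥ (e - Pᴴ *ᵥ y)) := by
    refine le_trans ?_ hw
    rw [hu, add_sub_assoc, ← Matrix.mulVec_sub, hpyth]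
    exact le_add_of_nonneg_right (energy_nonneg hAc _)
  have hκ0 : 0 < κ := lt_of_lt_of_le (by positivity) hκ
  have h4 : energy A e₂ / κ ≤ sqNorm (A *ᵥ (e - Pᴴ *ᵥ y)) / M := by
    rw [div_le_div_iff₀ hκ0 hM]
    have h5 : 0 ≤ sqNorm (A *ᵥ (e - Pᴴ *ᵥ y)) := by
      rw [sqNorm_eq_sum]; positivity
    calc _ ≤ γ * sqNorm (A *ᵥ (e - Pᴴ *ᵥ y)) * M := by gcongr
      _ = sqNorm (A *ᵥ (e - Pᴴ *ᵥ y)) * (M * γ) := by ring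
      _ ≤ _ := by gcongr
  rw [h2] at he'
  rw [h1]
  have h6 : (1 - 1 / κ) * (energy A e₂ + energy (P * A * Pᴴ) y') =
      energy A e₂ - energy A e₂ / κ + (1 - 1 / κ) * energy (P * A * Pᴴ) y' := by ring
  rw [h6]
  linarith

/-- The V-cycle contracts the squared energy norm, with a factor that does not depend on the number
of levels below. -/
theorem vcycle_energy_le {f : ℝ → ℝ} {q m₀ S νpre νpost : ℕ} {θ : ℕ → ℝ} (hS : 2 ^ S ∣ m₀)
    (hν : 1 ≤ νpost) (hθ : ∀ s, 0 < θ s ∧ θ s ≤ 2) {γ κ : ℝ} (hγ : 0 < γ) (hκ : 1 ≤ κ)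
    (hpos : ∀ s ≤ S, ∀ j : Fin (levelDim m₀ s),
      0 < levelSymbol f q m₀ s ((j : ℝ) * Real.pi / levelDim m₀ s))
    (hsup : ∀ s ≤ S, 0 < supNorm (levelSymbol f q m₀ s) ∧
      supNorm (levelSymbol f q m₀ s) * γ ≤ κ ∧
      ∀ x, levelSymbol f q m₀ s x ≤ supNorm (levelSymbol f q m₀ s))
    (happrox : ∀ s < S, ∀ u, ∃ w, energy (levelMatrix f q m₀ s) (u - (projector q m₀ s)ᴴ *ᵥ w) ≤
      γ * sqNorm (levelMatrix f q m₀ s *ᵥ u)) :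
    ∀ l s : ℕ, s + l = S → ∀ x b y : Fin (levelDim m₀ s) → ℂ, levelMatrix f q m₀ s *ᵥ x = b →
      energy (levelMatrix f q m₀ s) (vcycle f q m₀ νpre νpost θ l s y b - x) ≤
        (1 - 1 / κ) * energy (levelMatrix f q m₀ s) (y - x) := by
  have hcos : ∀ s ≤ S, levelMatrix f q m₀ s = cosMatrix (levelDim m₀ s) fun j =>
      ((levelSymbol f q m₀ s ((j : ℝ) * Real.pi / levelDim m₀ s) : ℝ) : ℂ) := fun s hs =>
    levelMatrix_eq_dctMatrix f q hS s hs
  have hpd : ∀ s ≤ S, (levelMatrix f q m₀ s).PosDef := fun s hs => by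
    rw [hcos s hs]
    exact cosMatrix_posDef (hpos s hs)
  have hκ0 : 0 ≤ 1 - 1 / κ := sub_nonneg.2 ((div_le_one (by linarith)).2 hκ)
  have hdet : ∀ s ≤ S, IsUnit (levelMatrix f q m₀ s).det := fun s hs =>
    (Matrix.isUnit_iff_isUnit_det _).1 (hpd s hs).isUnit
  intro l
  induction l with
  | zero =>
    intro s hs x b y hb
    have hsS : s ≤ S := by omega
    have h0 : (levelMatrix f q m₀ s)⁻¹ *ᵥ b - x = 0 := by
      rw [← hb, Matrix.mulVec_mulVec, Matrix.nonsing_inv_mul _ (hdet s hsS), Matrix.one_mulVec,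
        sub_self]
    rw [vcycle, h0, energy]
    simp only [Matrix.mulVec_zero, dotProduct_zero, Complex.zero_re]
    exact mul_nonneg hκ0 (energy_nonneg (hpd s hsS) _)
  | succ l ih =>
    intro s hs x b y hb
    have hsS : s ≤ S := by omega
    have hsS' : s + 1 ≤ S := by omega
    obtain ⟨hM, hMγ, hle⟩ := hsup s hsS
    rw [vcycle]
    set A := levelMatrix f q m₀ s with hA
    set P := projector q m₀ s
    set M := supNorm (levelSymbol f q m₀ s)
    set xpre := (richardson A (θ s / M) b)^[νpre] y with hxpre
    set yc := vcycle f q m₀ νpre νpost θ l (s + 1) 0 (P *ᵥ (A *ᵥ xpre - b))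
    have hAc : levelMatrix f q m₀ (s + 1) = P * A * Pᴴ := rfl
    have hpdc := hpd (s + 1) hsS'
    set y' := (levelMatrix f q m₀ (s + 1))⁻¹ *ᵥ (P *ᵥ (A *ᵥ xpre - b))
    have hres : A *ᵥ xpre - b = A *ᵥ (xpre - x) := by rw [Matrix.mulVec_sub, hb]
    have hy' : levelMatrix f q m₀ (s + 1) *ᵥ y' = P *ᵥ (A *ᵥ xpre - b) := by
      rw [Matrix.mulVec_mulVec, Matrix.mul_nonsing_inv _ (hdet _ hsS'), Matrix.one_mulVec]
    have hyc := ih (s + 1) (by omega) y' _ 0 hy'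
    have hneg : energy (levelMatrix f q m₀ (s + 1)) (0 - y') =
        energy (levelMatrix f q m₀ (s + 1)) y' := by
      rw [zero_sub, energy, energy, Matrix.mulVec_neg, star_neg, neg_dotProduct_neg]
    rw [hneg] at hyc
    have hpre : energy A (xpre - x) ≤ energy A (y - x) := by
      have hb' := hb
      rw [hxpre]
      rw [hA, hcos s hsS] at hb' ⊢
      exact energy_richardson_iterate_le (hpos s hsS) hM (fun j => hle _) (hθ s) hb' νpre y
    refine le_trans ?_ (mul_le_mul_of_nonneg_left hpre hκ0)
    refine energy_coarse_correction_le (P := P) (y := yc) (y' := y') (hpd s hsS) hpdc hM hγ hMγ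
      (happrox s (by omega)) ?_ hyc ?_
    · rw [← hres, ← hy', hAc]
    · have he : xpre - x - Pᴴ *ᵥ yc = (xpre - Pᴴ *ᵥ yc) - x := by abel
      rw [he]
      have hb' := hb
      rw [hA, hcos s hsS] at hb' ⊢
      exact energy_richardson_iterate_le_sub (hpos s hsS) hM (fun j => hle _) hb' hν _

/-! ### Composition of straight-line programs -/

section Programs

variable {n : ℕ}

theorem runCode_append_singleton (x : Fin n → ℂ) (code : List (Instr n)) (ins : Instr n) :
    runCode x (code ++ [ins]) = runCode x code ++
      [ins.op.apply (ins.left.value x (runCode x code)) (ins.right.value x (runCode x code))] := by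
  simp [runCode, List.foldl_append]

theorem length_runCode (x : Fin n → ℂ) (code : List (Instr n)) :
    (runCode x code).length = code.length := by
  induction code using List.reverseRecOn with
  | nil => rfl
  | append_singleton l a ih => rw [runCode_append_singleton]; simp [ih]

/-- The function `g` of the inputs is the result of an instruction of the program. -/
def IsResult (code : List (Instr n)) (g : (Fin n → ℂ) → ℂ) : Prop :=
  ∃ k < code.length, ∀ x, (runCode x code).getD k 0 = g x

/-- The function `g` of the inputs can be used as an operand after the program: it is an input,
a constant, or the result of an instruction. -/
def IsAvailable (code : List (Instr n)) (g : (Fin n → ℂ) → ℂ) : Prop :=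
  (∃ i, g = fun x => x i) ∨ (∃ c, g = fun _ => c) ∨ IsResult code g

theorem IsResult.append {code : List (Instr n)} {g : (Fin n → ℂ) → ℂ} (h : IsResult code g)
    (code' : List (Instr n)) : IsResult (code ++ code') g := by
  induction code' using List.reverseRecOn with
  | nil => rwa [List.append_nil]
  | append_singleton l a ih =>
    obtain ⟨k, hk, hg⟩ := ih
    refine ⟨k, by simp only [List.length_append] at hk ⊢; omega, fun x => ?_⟩
    rw [← List.append_assoc, runCode_append_singleton, List.getD_append _ _ _ _
      (by rwa [length_runCode]), hg]

theorem IsAvailable.append {code : List (Instr n)} {g : (Fin n → ℂ) → ℂ} (h : IsAvailable code g)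
    (code' : List (Instr n)) : IsAvailable (code ++ code') g :=
  h.imp_right fun h => h.imp_right fun h => h.append code'

theorem IsAvailable.exists_operand {code : List (Instr n)} {g : (Fin n → ℂ) → ℂ}
    (h : IsAvailable code g) : ∃ o : Operand n, ∀ x, o.value x (runCode x code) = g x := by
  rcases h with ⟨i, rfl⟩ | ⟨c, rfl⟩ | ⟨k, _, hk⟩
  · exact ⟨.input i, fun _ => rfl⟩
  · exact ⟨.const c, fun _ => rfl⟩
  · exact ⟨.reg k, hk⟩

theorem isAvailable_const (code : List (Instr n)) (c : ℂ) : IsAvailable code fun _ => c :=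
  Or.inr (Or.inl ⟨c, rfl⟩)

theorem IsAvailable.exists_instr {code : List (Instr n)} {u v : (Fin n → ℂ) → ℂ}
    (hu : IsAvailable code u) (hv : IsAvailable code v) (op : ArithOp) :
    ∃ ins : Instr n, IsResult (code ++ [ins]) fun x => op.apply (u x) (v x) := by
  obtain ⟨o₁, h₁⟩ := hu.exists_operand
  obtain ⟨o₂, h₂⟩ := hv.exists_operand
  refine ⟨⟨op, o₁, o₂⟩, code.length, by simp, fun x => ?_⟩
  rw [runCode_append_singleton, ← length_runCode x code]
  simp [h₁, h₂]

/-- After every extension of the program, the function `g` is obtained with at most `c` further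
instructions. -/
def ExprCost (code : List (Instr n)) (g : (Fin n → ℂ) → ℂ) (c : ℕ) : Prop :=
  ∀ e : List (Instr n), ∃ code', code'.length ≤ c ∧ IsAvailable (code ++ e ++ code') g

theorem IsAvailable.exprCost {code : List (Instr n)} {g : (Fin n → ℂ) → ℂ}
    (h : IsAvailable code g) : ExprCost code g 0 :=
  fun e => ⟨[], le_rfl, by simpa using h.append e⟩

theorem ExprCost.op {code : List (Instr n)} {u v : (Fin n → ℂ) → ℂ} {a b : ℕ}
    (hu : ExprCost code u a) (hv : ExprCost code v b) (op : ArithOp) :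
    ExprCost code (fun x => op.apply (u x) (v x)) (a + b + 1) := by
  intro e
  obtain ⟨c₁, hl₁, h₁⟩ := hu e
  obtain ⟨c₂, hl₂, h₂⟩ := hv (e ++ c₁)
  rw [← List.append_assoc] at h₂
  obtain ⟨ins, h₃⟩ := (h₁.append c₂).exists_instr h₂ op
  refine ⟨c₁ ++ c₂ ++ [ins], ?_, Or.inr (Or.inr ?_)⟩
  · simp only [List.length_append, List.length_singleton]
    omega
  · simpa only [List.append_assoc] using h₃

theorem ExprCost.add {code : List (Instr n)} {u v : (Fin n → ℂ) → ℂ} {a b : ℕ}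
    (hu : ExprCost code u a) (hv : ExprCost code v b) :
    ExprCost code (fun x => u x + v x) (a + b + 1) := hu.op hv .add

theorem ExprCost.sub {code : List (Instr n)} {u v : (Fin n → ℂ) → ℂ} {a b : ℕ}
    (hu : ExprCost code u a) (hv : ExprCost code v b) :
    ExprCost code (fun x => u x - v x) (a + b + 1) := hu.op hv .sub

theorem ExprCost.const_mul {code : List (Instr n)} {u : (Fin n → ℂ) → ℂ} {a : ℕ}
    (hu : ExprCost code u a) (c : ℂ) : ExprCost code (fun x => c * u x) (a + 1) := by
  have := (isAvailable_const code c).exprCost.op hu .mul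
  rwa [zero_add] at this

theorem ExprCost.mono {code : List (Instr n)} {u : (Fin n → ℂ) → ℂ} {a b : ℕ}
    (hu : ExprCost code u a) (hab : a ≤ b) : ExprCost code u b := fun e =>
  let ⟨c, hl, h⟩ := hu e
  ⟨c, hl.trans hab, h⟩

/-- Quantities that are obtained one after the other, each with at most `c` instructions. -/
theorem exists_code_of_step (Q : ℕ → List (Instr n) → Prop)
    (hQ : ∀ i code code', Q i code → Q i (code ++ code')) (code : List (Instr n)) (k c : ℕ)
    (step : ∀ i < k, ∀ e, (∀ j < i, Q j (code ++ e)) →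
      ∃ code', code'.length ≤ c ∧ Q i (code ++ e ++ code')) :
    ∃ code', code'.length ≤ k * c ∧ ∀ i < k, Q i (code ++ code') := by
  induction k with
  | zero => exact ⟨[], by simp, fun i hi => absurd hi (Nat.not_lt_zero i)⟩
  | succ k ih =>
    obtain ⟨e, hl, he⟩ := ih fun i hi => step i (hi.trans k.lt_succ_self)
    obtain ⟨e', hl', he'⟩ := step k k.lt_succ_self e he
    refine ⟨e ++ e', ?_, fun i hi => ?_⟩
    · rw [List.length_append]
      linarith
    · rw [← List.append_assoc]
      rcases Nat.lt_succ_iff_lt_or_eq.1 hi with h | rfl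
      · exact hQ _ _ _ (he i h)
      · exact he'

theorem exists_code_of_exprCost (g : ℕ → (Fin n → ℂ) → ℂ) (code : List (Instr n)) (k c : ℕ)
    (step : ∀ i < k, ∀ e, (∀ j < i, IsAvailable (code ++ e) (g j)) →
      ExprCost (code ++ e) (g i) c) :
    ∃ code', code'.length ≤ k * c ∧ ∀ i < k, IsAvailable (code ++ code') (g i) :=
  exists_code_of_step (fun i code => IsAvailable code (g i)) (fun _ _ code' h => h.append code')
    code k c fun i hi e he => by simpa using step i hi e he []

end Programs

/-- The map `Φ` can be appended to every program at the cost of at most `N` instructions: from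
available arguments, its values become available. -/
def HasCost {a b : ℕ} (Φ : (Fin a → ℂ) → Fin b → ℂ) (N : ℕ) : Prop :=
  ∀ (n : ℕ) (code : List (Instr n)) (u : Fin a → (Fin n → ℂ) → ℂ), (∀ j, IsAvailable code (u j)) →
    ∃ code', code'.length ≤ N ∧ ∀ i, IsAvailable (code ++ code') fun x => Φ (fun j => u j x) i

namespace HasCost

variable {a b c : ℕ}

theorem mono {Φ : (Fin a → ℂ) → Fin b → ℂ} {N M : ℕ} (h : HasCost Φ N) (hNM : N ≤ M) :
    HasCost Φ M := fun n code u hu =>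
  let ⟨code', hl, h'⟩ := h n code u hu
  ⟨code', hl.trans hNM, h'⟩

theorem id : HasCost (fun v : Fin a → ℂ => v) 0 := fun _ code _ hu =>
  ⟨[], le_rfl, fun i => by simpa using hu i⟩

theorem comp {Ψ : (Fin b → ℂ) → Fin c → ℂ} {Φ : (Fin a → ℂ) → Fin b → ℂ} {N M : ℕ}
    (hΨ : HasCost Ψ M) (hΦ : HasCost Φ N) : HasCost (fun v => Ψ (Φ v)) (N + M) := by
  intro n code u hu
  obtain ⟨c₁, hl₁, h₁⟩ := hΦ n code u hu
  obtain ⟨c₂, hl₂, h₂⟩ := hΨ n (code ++ c₁) _ h₁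
  refine ⟨c₁ ++ c₂, ?_, fun i => ?_⟩
  · rw [List.length_append]; omega
  · rw [← List.append_assoc]; exact h₂ i

theorem of_exprCost {Φ : (Fin a → ℂ) → Fin b → ℂ} {k : ℕ}
    (h : ∀ (n : ℕ) (code : List (Instr n)) (u : Fin a → (Fin n → ℂ) → ℂ),
      (∀ j, ExprCost code (u j) 0) → ∀ i, ExprCost code (fun x => Φ (fun j => u j x) i) k) :
    HasCost Φ (b * k) := by
  intro n code u hu
  obtain ⟨code', hl, h'⟩ := exists_code_of_exprCost
    (fun i x => if hi : i < b then Φ (fun j => u j x) ⟨i, hi⟩ else 0) code b k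
    (fun i hi e _ => by
      simp only [dif_pos hi]
      exact h n (code ++ e) u (fun j => ((hu j).append e).exprCost) ⟨i, hi⟩)
  refine ⟨code', hl, fun i => ?_⟩
  have := h' i i.2
  simpa only [dif_pos i.2] using this

theorem combine {Φ Ψ : (Fin a → ℂ) → Fin b → ℂ} {N M : ℕ} (hΦ : HasCost Φ N) (hΨ : HasCost Ψ M)
    (op : ArithOp) : HasCost (fun v i => op.apply (Φ v i) (Ψ v i)) (N + M + b) := by
  intro n code u hu
  obtain ⟨c₁, hl₁, h₁⟩ := hΦ n code u hu
  obtain ⟨c₂, hl₂, h₂⟩ := hΨ n (code ++ c₁) u fun j => (hu j).append c₁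
  obtain ⟨c₃, hl₃, h₃⟩ := exists_code_of_exprCost
    (fun i x => if hi : i < b then op.apply (Φ (fun j => u j x) ⟨i, hi⟩)
      (Ψ (fun j => u j x) ⟨i, hi⟩) else 0) (code ++ c₁ ++ c₂) b 1
    (fun i hi e _ => by
      simp only [dif_pos hi]
      exact (((h₁ ⟨i, hi⟩).append c₂).append e).exprCost.op ((h₂ ⟨i, hi⟩).append e).exprCost op)
  refine ⟨c₁ ++ c₂ ++ c₃, ?_, fun i => ?_⟩
  · simp only [List.length_append]; omega
  · have := h₃ i i.2
    simpa only [dif_pos i.2, List.append_assoc] using this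

theorem add {Φ Ψ : (Fin a → ℂ) → Fin b → ℂ} {N M : ℕ} (hΦ : HasCost Φ N) (hΨ : HasCost Ψ M) :
    HasCost (fun v => Φ v + Ψ v) (N + M + b) := hΦ.combine hΨ .add

theorem sub {Φ Ψ : (Fin a → ℂ) → Fin b → ℂ} {N M : ℕ} (hΦ : HasCost Φ N) (hΨ : HasCost Ψ M) :
    HasCost (fun v => Φ v - Ψ v) (N + M + b) := hΦ.combine hΨ .sub

theorem smul {Φ : (Fin a → ℂ) → Fin b → ℂ} {N : ℕ} (hΦ : HasCost Φ N) (z : ℂ) :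
    HasCost (fun v => z • Φ v) (N + b) := by
  have h : HasCost (fun v : Fin b → ℂ => z • v) (b * 1) :=
    of_exprCost fun n code u hu i => (hu i).const_mul z
  rw [mul_one] at h
  exact h.comp hΦ

theorem dotProduct (h : Fin a → ℂ) : HasCost (fun v (_ : Fin 1) => h ⬝ᵥ v) (2 * a) := by
  intro n code u hu
  obtain ⟨code', hl, h'⟩ := exists_code_of_exprCost
    (fun i x => ∑ j ∈ Finset.range (i + 1), if hj : j < a then h ⟨j, hj⟩ * u ⟨j, hj⟩ x else 0)
    code a 2 (fun i hi e he => by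
      simp only [Finset.sum_range_succ, dif_pos hi]
      rcases i with _ | i
      · simp only [Finset.range_zero, Finset.sum_empty, zero_add]
        exact (((hu ⟨0, hi⟩).append e).exprCost.const_mul _).mono (by norm_num)
      · exact (he i (Nat.lt_succ_self i)).exprCost.add
          (((hu ⟨i + 1, hi⟩).append e).exprCost.const_mul _))
  refine ⟨code', by omega, fun _ => ?_⟩
  rcases Nat.eq_zero_or_pos a with rfl | ha
  · simp only [_root_.dotProduct, Finset.univ_eq_empty, Finset.sum_empty]
    exact isAvailable_const _ _
  · have := h' (a - 1) (by omega)
    rw [Nat.sub_add_cancel ha] at this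
    convert this using 2 with x
    change ∑ j, h j * u j x = _
    rw [← Fin.sum_univ_eq_sum_range
      (fun j => if hj : j < a then h ⟨j, hj⟩ * u ⟨j, hj⟩ x else 0)]
    exact Finset.sum_congr rfl fun j _ => by simp

theorem vecMulVec (g : Fin b → ℂ) (h : Fin a → ℂ) :
    HasCost (fun v => Matrix.vecMulVec g h *ᵥ v) (2 * a + b) := by
  have h1 : HasCost (fun (v : Fin 1 → ℂ) (i : Fin b) => g i * v 0) (b * 1) :=
    of_exprCost fun n code u hu i => (hu 0).const_mul (g i)
  rw [mul_one] at h1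
  have h2 := h1.comp (dotProduct h)
  convert h2 using 3 with v i
  simp [Matrix.mulVec, _root_.dotProduct, Matrix.vecMulVec_apply, Finset.mul_sum, mul_assoc]

end HasCost

theorem matVecComplexity_le {n p N : ℕ} {B : Matrix (Fin p) (Fin n) ℂ}
    (h : HasCost (fun v => B *ᵥ v) N) : matVecComplexity B ≤ (N + p : ℕ) := by
  obtain ⟨c₁, hl₁, h₁⟩ := h n [] (fun j x => x j) fun j => Or.inl ⟨j, rfl⟩
  rw [List.nil_append] at h₁
  -- an output has to be the result of an instruction: a zero is added to each component
  obtain ⟨c₂, hl₂, h₂⟩ := exists_code_of_step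
    (fun i code => ∀ hi : i < p, IsResult code fun x => (B *ᵥ x) ⟨i, hi⟩)
    (fun i code code' hc hi => (hc hi).append code') c₁ p 1 (fun i hi e _ => by
      obtain ⟨ins, hins⟩ := ((h₁ ⟨i, hi⟩).append e).exists_instr (isAvailable_const _ 0) .add
      refine ⟨[ins], le_rfl, fun _ => ?_⟩
      simpa [ArithOp.apply] using hins)
  choose out hout hval using fun i : Fin p => h₂ i i.2 i.2
  refine (iInf₂_le (⟨c₁ ++ c₂, fun i => ⟨out i, hout i⟩⟩ : StraightLineProgram n p)
    fun x => funext fun i => hval i x).trans ?_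
  have : (c₁ ++ c₂).length ≤ N + p := by
    rw [List.length_append]; omega
  exact_mod_cast this

/-- A program for an invertible matrix has at least one instruction for each output. -/
theorem le_matVecComplexity {m : ℕ} {A : Matrix (Fin m) (Fin m) ℂ} (hA : IsUnit A.det) :
    (m : ℕ∞) ≤ matVecComplexity A := by
  refine le_iInf₂ fun S hS => ?_
  have hinj : Function.Injective S.out := by
    intro i j hij
    by_contra hne
    have h1 : ∀ x, (A *ᵥ x) i = (A *ᵥ x) j := fun x => by
      rw [← hS, StraightLineProgram.eval, StraightLineProgram.eval, hij]
    have h2 := h1 (A⁻¹ *ᵥ Pi.single i 1)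
    rw [Matrix.mulVec_mulVec, Matrix.mul_nonsing_inv _ hA, Matrix.one_mulVec] at h2
    simp [Pi.single_eq_of_ne (Ne.symm hne)] at h2
  have := Fintype.card_le_of_injective _ hinj
  simp only [Fintype.card_fin] at this
  exact_mod_cast this

/-! ### Linear complexity of the matrices and of their inverses -/

/-- The value of the cosine at a grid point. -/
noncomputable def gridCos (m : ℕ) (j : Fin m) : ℂ := (Real.cos ((j : ℝ) * Real.pi / m) : ℂ)

theorem gridCos_injective (m : ℕ) : Function.Injective (gridCos m) := by
  intro j k h
  have hm : (0 : ℝ) < m := by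
    have := j.2
    exact_mod_cast (by omega : 0 < m)
  have hmem : ∀ i : Fin m, (i : ℝ) * Real.pi / m ∈ Set.Icc 0 Real.pi := fun i => by
    refine ⟨by positivity, ?_⟩
    rw [div_le_iff₀ hm, mul_comm]
    have : (i : ℝ) ≤ m := by exact_mod_cast i.2.le
    gcongr
  have h1 := Real.injOn_cos (hmem j) (hmem k) (Complex.ofReal_injective h)
  have hpi := Real.pi_pos
  field_simp at h1
  exact Fin.ext (by exact_mod_cast h1)

theorem cosMatrix_gridCos_sub_mulVec {m : ℕ} (z : ℂ) (v : Fin m → ℂ) (i : Fin m) :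
    (cosMatrix m (fun j => gridCos m j - z) *ᵥ v) i =
      (v (leftNbr i) + v (rightNbr i)) / 2 - z * v i := by
  have h : cosMatrix m (fun j => gridCos m j - z) = cosMatrix m (gridCos m) - z • 1 := by
    rw [← cosMatrix_one, ← cosMatrix_smul, ← cosMatrix_sub]
    simp
  rw [h, Matrix.sub_mulVec, Matrix.smul_mulVec, Matrix.one_mulVec, Pi.sub_apply]
  have := cosMatrix_cos_mulVec v i
  rw [show cosMatrix m (gridCos m) = cosMatrix m (fun j => (Real.cos ((j : ℝ) * Real.pi / m) : ℂ))
    from rfl, this]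
  rfl

theorem hasCost_gridCos_sub (m : ℕ) (z : ℂ) :
    HasCost (fun v => cosMatrix m (fun j => gridCos m j - z) *ᵥ v) (4 * m) := by
  rw [mul_comm]
  refine HasCost.of_exprCost fun n code u hu i => ?_
  have h := (((hu (leftNbr i)).add (hu (rightNbr i))).const_mul (1 / 2)).sub ((hu i).const_mul z)
  convert h using 2 with x
  rw [cosMatrix_gridCos_sub_mulVec]
  ring

/-- Forward substitution in all equations but the last one of the system with matrix
`C(cos - z)` and right-hand side `b`, starting from the value `0`. -/
noncomputable def shoot (z : ℂ) (b : ℕ → ℂ) : ℕ → ℂ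
  | 0 => 0
  | 1 => 2 * b 0
  | i + 2 => 2 * (b (i + 1) + z * shoot z b (i + 1)) - shoot z b i

/-- The vector of the values of `shoot`. -/
noncomputable def shootVec {m : ℕ} (z : ℂ) (b : Fin m → ℂ) (i : Fin m) : ℂ :=
  shoot z (fun k => if h : k < m then b ⟨k, h⟩ else 0) i

theorem hasCost_shootVec (m : ℕ) (z : ℂ) : HasCost (shootVec (m := m) z) (4 * m) := by
  intro n code u hu
  obtain ⟨code', hl, h'⟩ := exists_code_of_exprCost
    (fun i x => shoot z (fun k => if h : k < m then u ⟨k, h⟩ x else 0) i) code m 4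
    (fun i hi e he => by
      rcases i with _ | _ | i
      · simp only [shoot]
        exact (isAvailable_const _ _).exprCost.mono (by norm_num)
      · have h0 : 0 < m := by omega
        simp only [shoot, dif_pos h0]
        exact (((hu ⟨0, h0⟩).append e).exprCost.const_mul 2).mono (by norm_num)
      · have h1 : i + 1 < m := by omega
        simp only [shoot, dif_pos h1]
        exact (((((hu ⟨i + 1, h1⟩).append e).exprCost.add
          ((he (i + 1) (by omega)).exprCost.const_mul z)).const_mul 2).sub
          (he i (by omega)).exprCost).mono (by norm_num))
  exact ⟨code', by omega, fun i => h' i i.2⟩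

/-- The residual of forward substitution is supported on the last component. -/
theorem gridCos_sub_mulVec_shootVec {m : ℕ} (z : ℂ) (b : Fin m → ℂ) (i : Fin m)
    (hi : (i : ℕ) + 1 < m) :
    (cosMatrix m (fun j => gridCos m j - z) *ᵥ shootVec z b) i = b i := by
  have hr : (rightNbr i : ℕ) = i + 1 := by simp only [rightNbr]; omega
  have hl : (leftNbr i : ℕ) = i - 1 := rfl
  rw [cosMatrix_gridCos_sub_mulVec, shootVec, shootVec, shootVec, hr, hl]
  obtain ⟨i, him⟩ := i
  rcases i with _ | i
  · simp [shoot, him]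
  · simp only [Nat.add_sub_cancel, shoot, dif_pos him]
    ring

/-- The pseudo-inverse of `C(cos - z)` has linear complexity. It differs from forward substitution
by two maps of rank at most one: one corrects the last equation, the other projects onto the kernel
of `C(cos - z)`, which is nonzero when `z` is a value of the cosine on the grid (there the
convention `0⁻¹ = 0` selects the pseudo-inverse). -/
theorem hasCost_gridCos_sub_inv {m : ℕ} (hm : 0 < m) (z : ℂ) :
    HasCost (fun v => cosMatrix m (fun j => (gridCos m j - z)⁻¹) *ᵥ v) (25 * m) := by
  set X := cosMatrix m (fun j => gridCos m j - z) with hX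
  set Y := cosMatrix m (fun j => (gridCos m j - z)⁻¹) with hY
  set E := cosMatrix m (fun j => if gridCos m j = z then 1 else 0) with hE
  have hYX : Y * X = 1 - E := by
    rw [hY, hX, hE, cosMatrix_mul, ← cosMatrix_one, ← cosMatrix_sub]
    congr 1
    ext j
    by_cases h : gridCos m j = z
    · simp [h]
    · rw [if_neg h, inv_mul_cancel₀ (sub_ne_zero.2 h), sub_zero]
  have hEcost : HasCost (fun v => E *ᵥ v) (3 * m) := by
    by_cases h : ∃ j, gridCos m j = z
    · obtain ⟨j, hj⟩ := h
      have hrank : E = Matrix.vecMulVec (fun i => dctTransform m i j)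
          (fun i => dctTransform m i j) := by
        ext i k
        rw [hE, cosMatrix, Matrix.mul_apply, Finset.sum_eq_single j]
        · simp [Matrix.mul_diagonal, hj, Matrix.vecMulVec_apply]
        · intro l _ hl
          have : gridCos m l ≠ z := fun h => hl (gridCos_injective m (h.trans hj.symm))
          simp [Matrix.mul_diagonal, this]
        · intro h
          exact absurd (Finset.mem_univ _) h
      rw [hrank]
      exact (HasCost.vecMulVec _ _).mono (by omega)
    · have h0 : E = cosMatrix m (fun j => 0 * 1) := by
        rw [hE]
        congr 1
        ext j
        rw [if_neg fun h' => h ⟨j, h'⟩, zero_mul]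
      rw [h0, cosMatrix_smul, zero_smul]
      refine (HasCost.of_exprCost (k := 0) fun n code u hu i => ?_).mono (by omega)
      simp only [Matrix.zero_mulVec]
      exact (isAvailable_const _ _).exprCost
  obtain ⟨last, hm1⟩ : ∃ i : Fin m, (i : ℕ) = m - 1 := ⟨⟨m - 1, by omega⟩, rfl⟩
  have hYlast : HasCost (fun (r : Fin m → ℂ) i => Y i last * r last) (m * 1) :=
    HasCost.of_exprCost fun n code u hu i => (hu last).const_mul _
  have hshoot := hasCost_shootVec m z
  have hres : HasCost (fun v => v - X *ᵥ shootVec z v) (0 + (4 * m + 4 * m) + m) :=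
    HasCost.id.sub ((hasCost_gridCos_sub m z).comp hshoot)
  have htotal := (hshoot.sub (hEcost.comp hshoot)).add (hYlast.comp hres)
  have hfun : (fun v => Y *ᵥ v) = fun v => shootVec z v - E *ᵥ shootVec z v +
      (fun i => Y i last * (v - X *ᵥ shootVec z v) last) := by
    funext v
    have h1 : Y *ᵥ (v - X *ᵥ shootVec z v) =
        fun i => Y i last * (v - X *ᵥ shootVec z v) last := by
      funext i
      rw [Matrix.mulVec, dotProduct, Finset.sum_eq_single last]
      · intro j _ hj
        have hj' : (j : ℕ) ≠ last := fun h => hj (Fin.ext h)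
        rw [Pi.sub_apply, hX, gridCos_sub_mulVec_shootVec z v j (by omega), sub_self, mul_zero]
      · intro h
        exact absurd (Finset.mem_univ _) h
    rw [← h1, Matrix.mulVec_sub, Matrix.mulVec_mulVec, hYX, Matrix.sub_mulVec, Matrix.one_mulVec]
    abel
  rw [hfun]
  exact htotal.mono (by omega)

theorem hasCost_multiset_prod {m c : ℕ} (d : ℂ → Fin m → ℂ)
    (h : ∀ z, HasCost (fun v => cosMatrix m (d z) *ᵥ v) c) (s : Multiset ℂ) :
    HasCost (fun v => cosMatrix m (fun j => (s.map fun z => d z j).prod) *ᵥ v)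
      (Multiset.card s * c) := by
  induction s using Multiset.induction_on with
  | empty =>
    simp only [Multiset.map_zero, Multiset.prod_zero, cosMatrix_one, Matrix.one_mulVec]
    exact HasCost.id.mono (Nat.zero_le _)
  | cons z s ih =>
    simp only [Multiset.map_cons, Multiset.prod_cons, Multiset.card_cons]
    have h2 := (h z).comp ih
    simp only [Matrix.mulVec_mulVec, cosMatrix_mul] at h2
    exact h2.mono (by linarith)

/-- The frequency-zero part of a matrix diagonal in the cosine basis. -/
theorem hasCost_frequency_zero {m : ℕ} (hm : 0 < m) :
    HasCost (fun v => cosMatrix m (fun j => if (j : ℕ) = 0 then 1 else 0) *ᵥ v) (3 * m) := by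
  have hrank : cosMatrix m (fun j => if (j : ℕ) = 0 then 1 else 0) =
      Matrix.vecMulVec (fun i => dctTransform m i ⟨0, hm⟩)
        (fun i => dctTransform m i ⟨0, hm⟩) := by
    ext i k
    rw [cosMatrix, Matrix.mul_apply, Finset.sum_eq_single ⟨0, hm⟩]
    · simp [Matrix.mul_diagonal, Matrix.vecMulVec_apply]
    · intro l _ hl
      rw [Ne, Fin.ext_iff] at hl
      simp only at hl
      simp [Matrix.mul_diagonal, hl]
    · intro h
      exact absurd (Finset.mem_univ _) h
  rw [hrank]
  exact (HasCost.vecMulVec _ _).mono (by omega)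

open Polynomial in
/-- A polynomial in `cos`, corrected at frequency zero, generates a matrix of linear complexity, and
so does its reciprocal. The factorization of the polynomial reduces this to linear factors. -/
theorem hasCost_polynomial {m : ℕ} (hm : 0 < m) {G : ℂ[X]} (hG1 : G.eval 1 = 0) {D : ℕ}
    (hD : G.natDegree ≤ D) (c : ℂ) :
    HasCost (fun v => cosMatrix m (fun j => G.eval (gridCos m j) +
        c * if (j : ℕ) = 0 then 1 else 0) *ᵥ v) ((25 * D + 6) * m) ∧
      HasCost (fun v => cosMatrix m (fun j => (G.eval (gridCos m j) +
        c * if (j : ℕ) = 0 then 1 else 0)⁻¹) *ᵥ v) ((25 * D + 6) * m) := by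
  have hcard : Multiset.card G.roots ≤ D := (card_roots' G).trans hD
  have hfac : ∀ t, G.eval t = G.leadingCoeff * (G.roots.map fun z => t - z).prod := by
    intro t
    conv_lhs => rw [(IsAlgClosed.splits G).eq_prod_roots]
    rw [eval_mul, eval_C, eval_multiset_prod, Multiset.map_map]
    simp
  have hfwd := hasCost_multiset_prod (fun z j => gridCos m j - z) (hasCost_gridCos_sub m) G.roots
  have hinv := hasCost_multiset_prod (fun z j => (gridCos m j - z)⁻¹) (hasCost_gridCos_sub_inv hm)
    G.roots
  have h0 := hasCost_frequency_zero hm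
  have hbound1 : Multiset.card G.roots * (4 * m) ≤ 25 * (D * m) := by nlinarith
  have hbound2 : Multiset.card G.roots * (25 * m) ≤ 25 * (D * m) := by nlinarith
  have hsplit : ∀ (x y : ℂ) (d e : Fin m → ℂ) (v : Fin m → ℂ),
      cosMatrix m (fun j => x * d j + y * e j) *ᵥ v =
        x • (cosMatrix m d *ᵥ v) + y • (cosMatrix m e *ᵥ v) := by
    intro x y d e v
    rw [cosMatrix_add m (fun j => x * d j) (fun j => y * e j), cosMatrix_smul, cosMatrix_smul,
      Matrix.add_mulVec, Matrix.smul_mulVec, Matrix.smul_mulVec]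
  constructor
  · have h := (hfwd.smul G.leadingCoeff).add (h0.smul c)
    simp only [← hsplit, ← hfac] at h
    exact h.mono (by linarith)
  · have h := (hinv.smul G.leadingCoeff⁻¹).add (h0.smul c⁻¹)
    simp only [← hsplit] at h
    have heq : (fun j : Fin m => (G.eval (gridCos m j) + c * if (j : ℕ) = 0 then 1 else 0)⁻¹) =
        fun j : Fin m => G.leadingCoeff⁻¹ * (G.roots.map fun z => (gridCos m j - z)⁻¹).prod +
          c⁻¹ * if (j : ℕ) = 0 then 1 else 0 := by
      ext j
      have hinvG : G.leadingCoeff⁻¹ * (G.roots.map fun z => (gridCos m j - z)⁻¹).prod =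
          (G.eval (gridCos m j))⁻¹ := by
        rw [hfac, mul_inv, Multiset.prod_map_inv]
      rw [hinvG]
      by_cases hj : (j : ℕ) = 0
      · have : gridCos m j = 1 := by simp [gridCos, hj]
        rw [this, hG1, if_pos hj]
        simp
      · simp [hj]
    rw [heq]
    exact h.mono (by linarith)

theorem hasCost_projPoly (q m : ℕ) :
    HasCost (fun v => dctMatrix m (projPoly q) *ᵥ v) (q * (4 * m)) := by
  have h := hasCost_multiset_prod (fun z j => gridCos m j - z) (hasCost_gridCos_sub m)
    (Multiset.replicate q (-1))
  rw [Multiset.card_replicate] at h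
  convert h using 3
  rw [dctMatrix_eq_cosMatrix]
  congr 1
  ext j
  simp [projPoly, gridCos, add_comm]

theorem hasCost_projector {q m₀ s : ℕ} (hs : levelDim m₀ s = 2 * levelDim m₀ (s + 1)) :
    HasCost (fun v => projector q m₀ s *ᵥ v) ((4 * q + 2) * levelDim m₀ s) ∧
      HasCost (fun v => (projector q m₀ s)ᴴ *ᵥ v) ((4 * q + 2) * levelDim m₀ s) := by
  have hp := hasCost_projPoly q (levelDim m₀ s)
  constructor
  · have hT : HasCost (fun v => cutting (levelDim m₀ (s + 1)) (levelDim m₀ s) *ᵥ v)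
        (levelDim m₀ (s + 1) * 2) := by
      refine HasCost.of_exprCost fun n code u hu i => ?_
      simp only [cutting_mulVec hs]
      exact ((hu _).add (hu _)).const_mul _
    have h := hT.comp hp
    simp only [Matrix.mulVec_mulVec] at h
    exact h.mono (by rw [add_mul]; nlinarith)
  · have hT : HasCost (fun v => (cutting (levelDim m₀ (s + 1)) (levelDim m₀ s))ᴴ *ᵥ v)
        (levelDim m₀ s * 1) := by
      refine HasCost.of_exprCost fun n code u hu i => ?_
      simp only [cutting_conjTranspose_mulVec hs]
      exact (hu _).const_mul _
    have hsymm : (dctMatrix (levelDim m₀ s) (projPoly q))ᴴ =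
        dctMatrix (levelDim m₀ s) (projPoly q) := by
      have ht : ((dctTransform (levelDim m₀ s))ᵀ)ᴴ = dctTransform (levelDim m₀ s) := by
        rw [← dctTransform_conjTranspose, Matrix.conjTranspose_conjTranspose]
      rw [dctMatrix, Matrix.conjTranspose_mul, Matrix.conjTranspose_mul, ht,
        dctTransform_conjTranspose, Matrix.diagonal_conjTranspose, Matrix.mul_assoc]
      congr 3
      ext j
      exact Complex.conj_ofReal _
    have h := hp.comp hT
    rw [projector, Matrix.conjTranspose_mul, hsymm]
    simp only [Matrix.mulVec_mulVec] at h
    exact h.mono (by rw [add_mul]; nlinarith)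

/-- The cost of the V-cycle is a geometric sum over the levels. -/
theorem vcycleCost_le {f : ℝ → ℝ} {q m₀ S νpre νpost c : ℕ} (hS : 2 ^ S ∣ m₀)
    (hA : ∀ s ≤ S, matVecComplexity (levelMatrix f q m₀ s) ≤ (c * levelDim m₀ s : ℕ) ∧
      matVecComplexity (levelMatrix f q m₀ s)⁻¹ ≤ (c * levelDim m₀ s : ℕ)) :
    ∀ l s : ℕ, s + l = S → vcycleCost f q m₀ νpre νpost l s ≤
      (2 * ((νpre + νpost + 1) * (c + 3) + 2 * (4 * q + 4)) * levelDim m₀ s : ℕ) := by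
  intro l
  induction l with
  | zero =>
    intro s hs
    rw [vcycleCost]
    refine (hA s (by omega)).2.trans ?_
    have : c ≤ 2 * ((νpre + νpost + 1) * (c + 3) + 2 * (4 * q + 4)) := by nlinarith
    exact_mod_cast Nat.mul_le_mul_right _ this
  | succ l ih =>
    intro s hs
    have hdim := levelDim_succ hS (show s < S by omega)
    obtain ⟨hP, hPH⟩ := hasCost_projector (q := q) hdim
    have h1 := (hA s (by omega)).1
    have h2 := matVecComplexity_le hP
    have h3 := matVecComplexity_le hPH
    have h4 := ih (s + 1) (by omega)
    have h5 : richardsonCost (levelMatrix f q m₀ s) ≤ ((c + 3) * levelDim m₀ s : ℕ) := by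
      rw [richardsonCost, add_mul]
      push_cast at h1 ⊢
      gcongr
    rw [vcycleCost]
    calc _ ≤ (νpre : ℕ∞) * ((c + 3) * levelDim m₀ s : ℕ) +
          ((c * levelDim m₀ s : ℕ) + levelDim m₀ s) +
          ((4 * q + 2) * levelDim m₀ s + levelDim m₀ (s + 1) : ℕ) +
          (2 * ((νpre + νpost + 1) * (c + 3) + 2 * (4 * q + 4)) * levelDim m₀ (s + 1) : ℕ) +
          (((4 * q + 2) * levelDim m₀ s + levelDim m₀ s : ℕ) + levelDim m₀ s) +
          (νpost : ℕ∞) * ((c + 3) * levelDim m₀ s : ℕ) := by gcongr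
      _ ≤ _ := by
        rw [hdim]
        norm_cast
        generalize levelDim m₀ (s + 1) = x
        ring_nf
        nlinarith [Nat.zero_le (q * x), Nat.zero_le x, Nat.zero_le (νpre * x)]

/-! ### Verification of the hypotheses at all levels -/

theorem zero_lt_one_sub_cos {x : ℝ} (h0 : 0 < x) (hpi : x ≤ Real.pi) : 0 < 1 - Real.cos x := by
  have := Real.cos_lt_cos_of_nonneg_of_le_pi le_rfl hpi h0
  rw [Real.cos_zero] at this
  linarith

/-- The Strang correction at level `s` is positive and bounded. -/
theorem strang_constant_bounds {f : ℝ → ℝ} {q : ℕ} {a b : ℝ} (ha : 0 < a) (hb : 0 < b)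
    (hab : ∀ x, a * (1 - Real.cos x) ^ q ≤ f x ∧ f x ≤ b * (1 - Real.cos x) ^ q) {m₀ S s : ℕ}
    (hm₀ : 0 < m₀) (hS : 2 ^ S ∣ m₀) (hs : s ≤ S) :
    0 < 4 ^ (q * s) * f (Real.pi / m₀) ∧
      4 ^ (q * s) * f (Real.pi / m₀) ≤ b * (Real.pi ^ 2 / 2) ^ q := by
  have hm : (1 : ℝ) ≤ m₀ := by exact_mod_cast hm₀
  have hpos := zero_lt_one_sub_cos (x := Real.pi / m₀) (div_pos Real.pi_pos (by positivity))
    (div_le_self Real.pi_pos.le hm)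
  obtain ⟨h1, h2⟩ := hab (Real.pi / m₀)
  refine ⟨mul_pos (by positivity) (lt_of_lt_of_le (by positivity) h1), ?_⟩
  have hle : 1 - Real.cos (Real.pi / m₀) ≤ (Real.pi / m₀) ^ 2 / 2 := by
    have := Real.one_sub_sq_div_two_le_cos (x := Real.pi / m₀)
    linarith
  have hdim : (2 : ℝ) ^ s ≤ m₀ := by
    have : 2 ^ s ≤ m₀ := Nat.le_of_dvd hm₀ ((pow_dvd_pow 2 hs).trans hS)
    exact_mod_cast this
  have h4 : (4 : ℝ) ^ s = 2 ^ s * 2 ^ s := by rw [← mul_pow]; norm_num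
  have hscaled : 4 ^ s * (1 - Real.cos (Real.pi / m₀)) ≤ Real.pi ^ 2 / 2 := by
    calc _ ≤ (4 : ℝ) ^ s * ((Real.pi / m₀) ^ 2 / 2) := by gcongr
      _ = (2 ^ s * 2 ^ s) / (m₀ * m₀) * (Real.pi ^ 2 / 2) := by rw [h4]; ring
      _ ≤ 1 * (Real.pi ^ 2 / 2) := by
        gcongr
        rw [div_le_one (by positivity)]
        gcongr
      _ = _ := one_mul _
  calc _ ≤ 4 ^ (q * s) * (b * (1 - Real.cos (Real.pi / m₀)) ^ q) := by gcongr
    _ = b * (4 ^ s * (1 - Real.cos (Real.pi / m₀))) ^ q := by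
      rw [mul_pow, ← pow_mul, mul_comm s q]; ring
    _ ≤ _ := by
      gcongr

open Polynomial in
/-- The properties of the symbols that are used at each level, with constants independent of the
level and of the hierarchy. -/
theorem levelSymbol_bounds {f : ℝ → ℝ} {q : ℕ} {F : ℝ[X]} (hF : ∀ x, f x = F.eval (Real.cos x))
    {a b : ℝ} (ha : 0 < a) (hb : 0 < b)
    (hab : ∀ t ∈ Set.Icc (-1 : ℝ) 1, a * (1 - t) ^ q ≤ F.eval t ∧ F.eval t ≤ b * (1 - t) ^ q)
    (hq : 0 < q) {m₀ S s : ℕ} (hm₀ : 0 < m₀) (hS : 2 ^ S ∣ m₀) (hs : s ≤ S) :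
    (∀ x, 0 ≤ levelSymbol f q m₀ s x) ∧
      (∀ x, levelSymbol f q m₀ s x ≤ b * 2 ^ q + b * (Real.pi ^ 2 / 2) ^ q) ∧
      0 < levelSymbol f q m₀ s 0 ∧
      (∀ x, 0 < x → x ≤ Real.pi →
        a * (2 / Real.pi) ^ (2 * (q + 1)) * (1 - Real.cos x) ^ q ≤ levelSymbol f q m₀ s x ∧
        levelSymbol f q m₀ s x ≤ b * 2 ^ q) ∧
      ∃ (G : ℂ[X]) (c : ℂ), G.natDegree ≤ max F.natDegree (2 * q + 1) ∧ G.eval 1 = 0 ∧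
        ∀ m, 0 < m → ∀ j : Fin m, ((levelSymbol f q m₀ s ((j : ℝ) * Real.pi / m) : ℝ) : ℂ) =
          G.eval (gridCos m j) + c * if (j : ℕ) = 0 then 1 else 0 := by
  obtain ⟨G, hdeg, hform, hup, hlow⟩ := levelSymbol_form hF ha hb hab m₀ s
  have hfab : ∀ x, a * (1 - Real.cos x) ^ q ≤ f x ∧ f x ≤ b * (1 - Real.cos x) ^ q := fun x => by
    rw [hF]
    exact hab _ ⟨Real.neg_one_le_cos x, Real.cos_le_one x⟩
  obtain ⟨hc0, hc1⟩ := strang_constant_bounds ha hb hfab hm₀ hS hs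
  have hGlow : ∀ x, 0 ≤ x → x ≤ Real.pi →
      a * (2 / Real.pi) ^ (2 * (q + 1)) * (1 - Real.cos x) ^ q ≤ G.eval (Real.cos x) := by
    intro x h0 hpi
    refine le_trans ?_ (hlow x ⟨h0, hpi⟩)
    have : 0 ≤ (1 - Real.cos x) ^ q := pow_nonneg (by linarith [Real.cos_le_one x]) q
    have := le_sincWeight q h0 hpi
    gcongr
  have hG0 : ∀ x, 0 ≤ G.eval (Real.cos x) := by
    intro x
    have h := hGlow (Real.arccos (Real.cos x)) (Real.arccos_nonneg _) (Real.arccos_le_pi _)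
    rw [Real.cos_arccos (Real.neg_one_le_cos x) (Real.cos_le_one x)] at h
    refine le_trans ?_ h
    have : 0 ≤ (1 - Real.cos x) ^ q := pow_nonneg (by linarith [Real.cos_le_one x]) q
    positivity
  have hGup : ∀ x, G.eval (Real.cos x) ≤ b * 2 ^ q := by
    intro x
    refine (hup _ ⟨Real.neg_one_le_cos x, Real.cos_le_one x⟩).trans ?_
    have h1 : 0 ≤ 1 - Real.cos x := by linarith [Real.cos_le_one x]
    have h2 : 1 - Real.cos x ≤ 2 := by linarith [Real.neg_one_le_cos x]
    gcongr
  have hG1 : G.eval 1 = 0 := by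
    refine le_antisymm ?_ ?_
    · simpa [hq.ne'] using hup 1 ⟨by norm_num, le_rfl⟩
    · simpa using hG0 0
  have hne : ∀ x, 0 < x → x ≤ Real.pi → Real.cos x ≠ 1 := fun x h0 hpi => by
    have := zero_lt_one_sub_cos h0 hpi
    intro h
    linarith
  refine ⟨fun x => ?_, fun x => ?_, ?_, fun x h0 hpi => ?_, ?_⟩
  · rw [hform]
    have := hG0 x
    split_ifs <;> linarith
  · rw [hform]
    have := hGup x
    split_ifs <;> linarith
  · rw [hform]
    simpa [hG1] using hc0
  · rw [hform, if_neg (hne x h0 hpi), mul_zero, add_zero]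
    exact ⟨hGlow x h0.le hpi, hGup x⟩
  · refine ⟨G.map (algebraMap ℝ ℂ), ((4 ^ (q * s) * f (Real.pi / m₀) : ℝ) : ℂ),
      natDegree_map_le.trans hdeg, ?_, fun m hm j => ?_⟩
    · rw [eval_map_algebraMap, ← map_one (algebraMap ℝ ℂ), aeval_algebraMap_apply,
        coe_aeval_eq_eval, hG1, map_zero]
    · have hiff : Real.cos ((j : ℝ) * Real.pi / m) = 1 ↔ (j : ℕ) = 0 := by
        constructor
        · intro h
          by_contra hj
          have hm' : (0 : ℝ) < m := by exact_mod_cast hm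
          have hj' : (0 : ℝ) < j := by exact_mod_cast Nat.pos_of_ne_zero hj
          refine hne _ (by have := Real.pi_pos; positivity) ?_ h
          rw [div_le_iff₀ hm', mul_comm]
          have : (j : ℝ) ≤ m := by exact_mod_cast j.2.le
          have := Real.pi_pos
          gcongr
        · intro h
          simp [h]
      rw [hform, gridCos, eval_map_algebraMap]
      have : (aeval (Real.cos ((j : ℝ) * Real.pi / m) : ℂ)) G =
          ((G.eval (Real.cos ((j : ℝ) * Real.pi / m)) : ℝ) : ℂ) := by
        rw [← Complex.coe_algebraMap, aeval_algebraMap_apply, coe_aeval_eq_eval]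
      rw [this]
      simp only [hiff]
      push_cast
      split_ifs <;> simp

/-- The approximation property at every level, with uniform constants. -/
theorem level_approximation {f : ℝ → ℝ} {q m₀ S s : ℕ} (hS : 2 ^ S ∣ m₀) (hs : s < S) {lo hi : ℝ}
    (hlo : 0 < lo) (hzero : 0 < levelSymbol f q m₀ s 0)
    (hbounds : ∀ x, 0 < x → x ≤ Real.pi →
      lo * (1 - Real.cos x) ^ q ≤ levelSymbol f q m₀ s x ∧ levelSymbol f q m₀ s x ≤ hi)
    (u : Fin (levelDim m₀ s) → ℂ) :
    ∃ w, energy (levelMatrix f q m₀ s) (u - (projector q m₀ s)ᴴ *ᵥ w) ≤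
      4 * (1 / lo + hi / lo ^ 2) * sqNorm (levelMatrix f q m₀ s *ᵥ u) := by
  have hdim := levelDim_succ hS hs
  rw [levelMatrix_eq_dctMatrix f q hS s hs.le, projector,
    dctMatrix_eq_cosMatrix _ (levelSymbol _ _ _ _)]
  generalize levelDim m₀ (s + 1) = m' at *
  generalize levelDim m₀ s = m at *
  have hpi := Real.pi_pos
  have hx : ∀ j, 0 < j → j < m → 0 < (j : ℝ) * Real.pi / m ∧ (j : ℝ) * Real.pi / m ≤ Real.pi := by
    intro j h0 hj
    have hm' : (0 : ℝ) < m := by exact_mod_cast (by omega : 0 < m)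
    have hj' : (0 : ℝ) < j := by exact_mod_cast h0
    have hjm : (j : ℝ) ≤ m := by exact_mod_cast hj.le
    refine ⟨by positivity, ?_⟩
    rw [div_le_iff₀ hm', mul_comm]
    gcongr
  have hcutsq : ∀ k : ℕ, cutSymbol m (projPoly q) k ^ 2 =
      (1 + Real.cos ((k : ℝ) * Real.pi / m)) / 2 *
        ((1 + Real.cos ((k : ℝ) * Real.pi / m)) ^ q) ^ 2 := by
    intro k
    rw [cutSymbol, projPoly, mul_pow, Real.cos_sq]
    rw [show 2 * ((k : ℝ) * Real.pi / m / 2) = (k : ℝ) * Real.pi / m by ring]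
    ring
  have hcospos : ∀ k < m', 0 ≤ Real.cos ((k : ℝ) * Real.pi / m) := by
    intro k hk
    have hm' : (0 : ℝ) < m := by exact_mod_cast (by omega : 0 < m)
    have hkm : (k : ℝ) * 2 ≤ m := by
      have : k * 2 ≤ m := by omega
      exact_mod_cast this
    refine Real.cos_nonneg_of_neg_pi_div_two_le_of_le ?_ ?_
    · have : 0 ≤ (k : ℝ) * Real.pi / m := by positivity
      linarith
    · rw [div_le_div_iff₀ hm' two_pos]
      nlinarith
  refine exists_coarse_approximation hdim (projPoly q)
    (d := fun j => levelSymbol f q m₀ s ((j : ℝ) * Real.pi / m)) ?_ hlo ?_ ?_ ?_ u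
  · intro j hj
    rcases Nat.eq_zero_or_pos j with rfl | h0
    · simpa using hzero
    · obtain ⟨hx0, hxpi⟩ := hx j h0 hj
      have := zero_lt_one_sub_cos hx0 hxpi
      exact lt_of_lt_of_le (by positivity) (hbounds _ hx0 hxpi).1
  · intro j hj hjm
    obtain ⟨hx0, hxpi⟩ := hx j (by omega) hjm
    obtain ⟨h1, h2⟩ := hbounds _ hx0 hxpi
    refine ⟨le_trans (le_mul_of_one_le_right hlo.le (one_le_pow₀ ?_)) h1, h2⟩
    have hm' : (0 : ℝ) < m := by exact_mod_cast (by omega : 0 < m)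
    have hge : (m : ℝ) ≤ j * 2 := by
      have : m ≤ j * 2 := by omega
      exact_mod_cast this
    have : Real.cos ((j : ℝ) * Real.pi / m) ≤ 0 := by
      refine Real.cos_nonpos_of_pi_div_two_le_of_le ?_ (by linarith)
      rw [div_le_div_iff₀ two_pos hm']
      nlinarith
    linarith
  · intro k hk h0
    have h1 := hcutsq k
    have h2 := hcospos k hk
    rw [h0] at h1
    have : 0 < (1 + Real.cos ((k : ℝ) * Real.pi / m)) / 2 *
        ((1 + Real.cos ((k : ℝ) * Real.pi / m)) ^ q) ^ 2 := by positivity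
    rw [← h1] at this
    norm_num at this
  · intro k h0 hk
    obtain ⟨hx0, hxpi⟩ := hx k h0 (by omega)
    have hm' : (m : ℝ) ≠ 0 := by
      have : 0 < m := by omega
      positivity
    have hrefl : ((m - k : ℕ) : ℝ) * Real.pi / m = Real.pi - (k : ℝ) * Real.pi / m := by
      rw [Nat.cast_sub (by omega)]
      field_simp
    have hb := (hbounds _ hx0 hxpi).1
    have hc := hcospos k hk
    have hc1 := Real.cos_le_one ((k : ℝ) * Real.pi / m)
    rw [hcutsq, hcutsq, hrefl, Real.cos_pi_sub]
    set c := Real.cos ((k : ℝ) * Real.pi / m)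
    have hs0 : 0 ≤ (1 - c) ^ q := pow_nonneg (by linarith) q
    have h1 : (1 : ℝ) ≤ (1 + c) ^ q := one_le_pow₀ (by linarith)
    have h2 : (lo * (1 - c) ^ q) ^ 2 ≤ levelSymbol f q m₀ s ((k : ℝ) * Real.pi / m) ^ 2 :=
      pow_le_pow_left₀ (by positivity) hb 2
    have h3 : (1 : ℝ) ≤ ((1 + c) ^ q) ^ 2 := one_le_pow₀ h1
    have h4 : (1 : ℝ) / 2 ≤ (1 + c) / 2 * ((1 + c) ^ q) ^ 2 := by nlinarith
    calc (1 + -c) / 2 * ((1 + -c) ^ q) ^ 2 * lo ^ 2 =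
          (1 - c) / 2 * (lo * (1 - c) ^ q) ^ 2 := by rw [← sub_eq_add_neg]; ring
      _ ≤ 1 / 2 * (lo * (1 - c) ^ q) ^ 2 := by gcongr; linarith
      _ = (lo * (1 - c) ^ q) ^ 2 * (1 / 2) := mul_comm _ _
      _ ≤ _ := by gcongr

/-- Convergence in the energy norm implies convergence. -/
theorem tendsto_of_energy {m : ℕ} {d : Fin m → ℝ} (hd : ∀ j, 0 < d j) {v : ℕ → Fin m → ℂ}
    {x : Fin m → ℂ} (h : Filter.Tendsto
      (fun k => energy (cosMatrix m fun j => (d j : ℂ)) (v k - x)) Filter.atTop (nhds 0)) :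
    Filter.Tendsto v Filter.atTop (nhds x) := by
  have hcoeff : Filter.Tendsto (fun k => coeff (v k - x)) Filter.atTop (nhds 0) := by
    rw [tendsto_pi_nhds]
    intro j
    have h1 : Filter.Tendsto (fun k => ‖coeff (v k - x) j‖ ^ 2) Filter.atTop (nhds 0) := by
      have h2 := h.div_const (d j)
      rw [zero_div] at h2
      refine squeeze_zero (fun k => sq_nonneg _) (fun k => ?_) h2
      rw [le_div_iff₀ (hd j), energy_cosMatrix, mul_comm]
      exact Finset.single_le_sum (f := fun j => d j * ‖coeff (v k - x) j‖ ^ 2)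
        (fun i _ => mul_nonneg (hd i).le (sq_nonneg _)) (Finset.mem_univ j)
    have h3 := h1.sqrt
    simp only [Real.sqrt_sq (norm_nonneg _), Real.sqrt_zero] at h3
    exact tendsto_zero_iff_norm_tendsto_zero.2 h3
  have hcont : Continuous fun c : Fin m → ℂ => dctTransform m *ᵥ c :=
    continuous_const.matrix_mulVec continuous_id
  have h4 := (hcont.tendsto 0).comp hcoeff
  rw [Matrix.mulVec_zero] at h4
  have h5 := h4.add_const x
  rw [zero_add] at h5
  refine h5.congr fun k => ?_
  simp only [Function.comp_apply, dctTransform_mulVec_coeff, sub_add_cancel]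

end DCTMultigrid

/-! ### Uniform convergence and optimality -/

theorem mainTheorem1 (f : ℝ → ℝ) (q : ℕ) (hq : 0 < q)
    (hf : DCTMultigrid.IsTrigPoly f) (heven : ∀ x, f (-x) = f x) (hnonneg : ∀ x, 0 ≤ f x)
    (hzero : ∀ x, f x = 0 ↔ ∃ k : ℤ, x = 2 * Real.pi * k)
    (hord : analyticOrderAt f 0 = ((2 * q : ℕ) : ℕ∞)) :
    -- the error reduction factor depends on `f` and `q` only
    ∃ ρ : ℝ, 0 ≤ ρ ∧ ρ < 1 ∧
      ∀ (νpre νpost : ℕ) (θ : ℕ → ℝ), 1 ≤ νpost → (∀ s, 0 < θ s ∧ θ s ≤ 2) →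
        -- well-posedness, linear convergence with rate `ρ`, convergence to the solution
        (∀ H : DCTMultigrid.Hierarchy,
          (∀ s ≤ H.sMin, (DCTMultigrid.levelMatrix f q H.m₀ s).PosDef) ∧
          ∀ b x : Fin (DCTMultigrid.levelDim H.m₀ 0) → ℂ, DCTMultigrid.levelMatrix f q H.m₀ 0 *ᵥ x = b →
            (∀ x₀ : Fin (DCTMultigrid.levelDim H.m₀ 0) → ℂ,
              DCTMultigrid.energyNorm (DCTMultigrid.levelMatrix f q H.m₀ 0)
                  (DCTMultigrid.vcycle f q H.m₀ νpre νpost θ H.sMin 0 x₀ b - x) ≤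
                ρ * DCTMultigrid.energyNorm (DCTMultigrid.levelMatrix f q H.m₀ 0) (x₀ - x)) ∧
            (∀ x₀ : Fin (DCTMultigrid.levelDim H.m₀ 0) → ℂ,
              Filter.Tendsto
                (fun k : ℕ =>
                  (fun y => DCTMultigrid.vcycle f q H.m₀ νpre νpost θ H.sMin 0 y b)^[k] x₀)
                Filter.atTop (nhds x))) ∧
        -- a cycle costs `O(m₀)` arithmetic operations
        (∃ C : ℕ, ∀ H : DCTMultigrid.Hierarchy,
          DCTMultigrid.vcycleCost f q H.m₀ νpre νpost H.sMin 0 ≤ C * H.m₀) ∧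
        -- optimality
        DCTMultigrid.IsOptimal (fun H : DCTMultigrid.Hierarchy => DCTMultigrid.levelDim H.m₀ 0)
          (fun H => DCTMultigrid.levelMatrix f q H.m₀ 0)
          (fun H b y => DCTMultigrid.vcycle f q H.m₀ νpre νpost θ H.sMin 0 y b)
          (fun H => DCTMultigrid.vcycleCost f q H.m₀ νpre νpost H.sMin 0) := by
  obtain ⟨F, hF⟩ := hf.exists_polynomial heven
  obtain ⟨a, b, ha, hb, hab⟩ := DCTMultigrid.symbol_comparable hnonneg hzero hord hF
  -- `lo`, `hi`: bounds for the symbols relative to `(1 - cos x)^q`, away from the zero;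
  -- `B`: bound for all `‖f_s‖_∞`; `γ`: constant of the approximation property
  set lo : ℝ := a * (2 / Real.pi) ^ (2 * (q + 1))
  have hlo : 0 < lo := by positivity
  set hi : ℝ := b * 2 ^ q
  have hhi : 0 < hi := by positivity
  set B : ℝ := b * 2 ^ q + b * (Real.pi ^ 2 / 2) ^ q
  set γ : ℝ := 4 * (1 / lo + hi / lo ^ 2)
  have hγ : 0 < γ := by positivity
  set κ : ℝ := max 1 (B * γ)
  have hκ : 1 ≤ κ := le_max_left _ _
  have hr0 : 0 ≤ 1 - 1 / κ := sub_nonneg.2 ((div_le_one (by linarith)).2 hκ)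
  have hr1 : 1 - 1 / κ < 1 := sub_lt_self _ (by positivity)
  have hbounds := fun (H : DCTMultigrid.Hierarchy) (s : ℕ) (hs : s ≤ H.sMin) =>
    DCTMultigrid.levelSymbol_bounds hF ha hb hab hq H.pos H.dvd hs
  have hdimpos : ∀ (H : DCTMultigrid.Hierarchy) (s : ℕ), s ≤ H.sMin →
      0 < DCTMultigrid.levelDim H.m₀ s := by
    intro H s hs
    have h1 := DCTMultigrid.levelDim_eq H.dvd s hs
    have h2 := H.pos
    rw [h1] at h2
    exact Nat.pos_of_mul_pos_left h2
  have hcos : ∀ (H : DCTMultigrid.Hierarchy) (s : ℕ), s ≤ H.sMin →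
      DCTMultigrid.levelMatrix f q H.m₀ s =
        DCTMultigrid.cosMatrix (DCTMultigrid.levelDim H.m₀ s) fun j =>
          ((DCTMultigrid.levelSymbol f q H.m₀ s
            ((j : ℝ) * Real.pi / DCTMultigrid.levelDim H.m₀ s) : ℝ) : ℂ) := fun H s hs =>
    DCTMultigrid.levelMatrix_eq_dctMatrix f q H.dvd s hs
  have hpos : ∀ (H : DCTMultigrid.Hierarchy) (s : ℕ), s ≤ H.sMin →
      ∀ j : Fin (DCTMultigrid.levelDim H.m₀ s), 0 < DCTMultigrid.levelSymbol f q H.m₀ s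
        ((j : ℝ) * Real.pi / DCTMultigrid.levelDim H.m₀ s) := by
    intro H s hs j
    obtain ⟨-, -, h0, hlow, -⟩ := hbounds H s hs
    rcases Nat.eq_zero_or_pos (j : ℕ) with hj | hj
    · simpa [hj] using h0
    · have hm : (0 : ℝ) < DCTMultigrid.levelDim H.m₀ s := by exact_mod_cast hdimpos H s hs
      have hj' : (0 : ℝ) < j := by exact_mod_cast hj
      have hx0 : 0 < (j : ℝ) * Real.pi / DCTMultigrid.levelDim H.m₀ s := by positivity
      have hxpi : (j : ℝ) * Real.pi / DCTMultigrid.levelDim H.m₀ s ≤ Real.pi := by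
        rw [div_le_iff₀ hm, mul_comm]
        have : (j : ℝ) ≤ DCTMultigrid.levelDim H.m₀ s := by exact_mod_cast j.2.le
        gcongr
      have := DCTMultigrid.zero_lt_one_sub_cos hx0 hxpi
      exact lt_of_lt_of_le (by positivity) (hlow _ hx0 hxpi).1
  have hpd : ∀ (H : DCTMultigrid.Hierarchy) (s : ℕ), s ≤ H.sMin →
      (DCTMultigrid.levelMatrix f q H.m₀ s).PosDef := fun H s hs => by
    rw [hcos H s hs]
    exact DCTMultigrid.cosMatrix_posDef (hpos H s hs)
  have hsup : ∀ (H : DCTMultigrid.Hierarchy) (s : ℕ), s ≤ H.sMin →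
      0 < DCTMultigrid.supNorm (DCTMultigrid.levelSymbol f q H.m₀ s) ∧
      DCTMultigrid.supNorm (DCTMultigrid.levelSymbol f q H.m₀ s) * γ ≤ κ ∧
      ∀ x, DCTMultigrid.levelSymbol f q H.m₀ s x ≤
        DCTMultigrid.supNorm (DCTMultigrid.levelSymbol f q H.m₀ s) := by
    intro H s hs
    obtain ⟨hnn, hleB, h0, -, -⟩ := hbounds H s hs
    have habs : ∀ x, |DCTMultigrid.levelSymbol f q H.m₀ s x| ≤ B := fun x => by
      rw [abs_of_nonneg (hnn x)]
      exact hleB x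
    have hle : ∀ x, DCTMultigrid.levelSymbol f q H.m₀ s x ≤
        DCTMultigrid.supNorm (DCTMultigrid.levelSymbol f q H.m₀ s) := fun x =>
      (le_abs_self _).trans (le_ciSup ⟨B, Set.forall_mem_range.2 habs⟩ x)
    refine ⟨h0.trans_le (hle 0), ?_, hle⟩
    exact (mul_le_mul_of_nonneg_right (ciSup_le habs) hγ.le).trans (le_max_right _ _)
  set ρ : ℝ := Real.sqrt (1 - 1 / κ) with hρ
  have hρ0 : 0 ≤ ρ := Real.sqrt_nonneg _
  have hρ1 : ρ < 1 := by
    rw [hρ, Real.sqrt_lt' one_pos]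
    simpa using hr1
  refine ⟨ρ, hρ0, hρ1, ?_⟩
  intro νpre νpost θ hν hθ
  have hcycle : ∀ (H : DCTMultigrid.Hierarchy) (b x y : Fin (DCTMultigrid.levelDim H.m₀ 0) → ℂ),
      DCTMultigrid.levelMatrix f q H.m₀ 0 *ᵥ x = b →
      DCTMultigrid.energyNorm (DCTMultigrid.levelMatrix f q H.m₀ 0)
        (DCTMultigrid.vcycle f q H.m₀ νpre νpost θ H.sMin 0 y b - x) ≤
      ρ * DCTMultigrid.energyNorm (DCTMultigrid.levelMatrix f q H.m₀ 0) (y - x) := by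
    intro H b x y hx
    have h := DCTMultigrid.vcycle_energy_le (νpre := νpre) (θ := θ) H.dvd hν hθ hγ hκ (hpos H)
      (hsup H) (fun s hs u => DCTMultigrid.level_approximation H.dvd hs hlo
        (hbounds H s hs.le).2.2.1 (hbounds H s hs.le).2.2.2.1 u) H.sMin 0 (Nat.zero_add _) x b y hx
    rw [hρ, DCTMultigrid.energyNorm, DCTMultigrid.energyNorm, ← Real.sqrt_mul hr0]
    exact Real.sqrt_le_sqrt h
  have hiter : ∀ (H : DCTMultigrid.Hierarchy) (b x y : Fin (DCTMultigrid.levelDim H.m₀ 0) → ℂ),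
      DCTMultigrid.levelMatrix f q H.m₀ 0 *ᵥ x = b → ∀ k : ℕ,
      DCTMultigrid.energyNorm (DCTMultigrid.levelMatrix f q H.m₀ 0)
        ((fun z => DCTMultigrid.vcycle f q H.m₀ νpre νpost θ H.sMin 0 z b)^[k] y - x) ≤
      ρ ^ k * DCTMultigrid.energyNorm (DCTMultigrid.levelMatrix f q H.m₀ 0) (y - x) := by
    intro H b x y hx k
    induction k with
    | zero => simp
    | succ k ih =>
      rw [Function.iterate_succ_apply', pow_succ', mul_assoc]
      exact (hcycle H b x _ hx).trans (mul_le_mul_of_nonneg_left ih hρ0)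
  set D : ℕ := max F.natDegree (2 * q + 1)
  have hcomplexity : ∀ (H : DCTMultigrid.Hierarchy) (s : ℕ), s ≤ H.sMin →
      DCTMultigrid.matVecComplexity (DCTMultigrid.levelMatrix f q H.m₀ s) ≤
        ((25 * D + 7) * DCTMultigrid.levelDim H.m₀ s : ℕ) ∧
      DCTMultigrid.matVecComplexity (DCTMultigrid.levelMatrix f q H.m₀ s)⁻¹ ≤
        ((25 * D + 7) * DCTMultigrid.levelDim H.m₀ s : ℕ) := by
    intro H s hs
    obtain ⟨-, -, -, -, G, c, hdeg, hG1, hval⟩ := hbounds H s hs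
    obtain ⟨h1, h2⟩ := DCTMultigrid.hasCost_polynomial (hdimpos H s hs) hG1 hdeg c
    have hN : (25 * D + 6) * DCTMultigrid.levelDim H.m₀ s + DCTMultigrid.levelDim H.m₀ s =
        (25 * D + 7) * DCTMultigrid.levelDim H.m₀ s := by ring
    rw [hcos H s hs, DCTMultigrid.cosMatrix_inv _ _
      (fun j => Complex.ofReal_ne_zero.2 (hpos H s hs j).ne')]
    simp only [hval _ (hdimpos H s hs)]
    rw [← hN]
    exact ⟨DCTMultigrid.matVecComplexity_le h1, DCTMultigrid.matVecComplexity_le h2⟩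
  obtain ⟨C, hC⟩ : ∃ C : ℕ, ∀ H : DCTMultigrid.Hierarchy,
      DCTMultigrid.vcycleCost f q H.m₀ νpre νpost H.sMin 0 ≤ C * H.m₀ := by
    refine ⟨2 * ((νpre + νpost + 1) * ((25 * D + 7) + 3) + 2 * (4 * q + 4)), fun H => ?_⟩
    have h := DCTMultigrid.vcycleCost_le (νpre := νpre) (νpost := νpost) H.dvd (hcomplexity H)
      H.sMin 0 (Nat.zero_add _)
    rw [Nat.cast_mul] at h
    exact h
  refine ⟨fun H => ⟨hpd H, fun b x hx => ⟨fun y => hcycle H b x y hx, fun y => ?_⟩⟩, ⟨C, hC⟩,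
    ⟨C, fun H => ?_⟩, fun ε hε => ?_⟩
  · have hpos0 := hpos H 0 (Nat.zero_le _)
    refine DCTMultigrid.tendsto_of_energy hpos0 ?_
    rw [← hcos H 0 (Nat.zero_le _)]
    have hlim : Filter.Tendsto (fun k : ℕ => (ρ ^ k *
        DCTMultigrid.energyNorm (DCTMultigrid.levelMatrix f q H.m₀ 0) (y - x)) ^ 2)
        Filter.atTop (nhds 0) := by
      have := (((tendsto_pow_atTop_nhds_zero_of_lt_one hρ0 hρ1).mul_const
        (DCTMultigrid.energyNorm (DCTMultigrid.levelMatrix f q H.m₀ 0) (y - x))).pow 2)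
      simpa using this
    have hnn := DCTMultigrid.energy_nonneg (hpd H 0 (Nat.zero_le _))
    refine squeeze_zero (fun k => hnn _) (fun k => ?_) hlim
    rw [← Real.sq_sqrt (hnn _)]
    exact pow_le_pow_left₀ (Real.sqrt_nonneg _) (hiter H b x y hx k) 2
  · refine (hC H).trans ?_
    gcongr
    exact DCTMultigrid.le_matVecComplexity
      ((Matrix.isUnit_iff_isUnit_det _).1 (hpd H 0 (Nat.zero_le _)).isUnit)
  · obtain ⟨K, hK⟩ := exists_pow_lt_of_lt_one hε hρ1
    refine ⟨K, fun H b x y hx k hk => (hiter H b x y hx k).trans ?_⟩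
    refine mul_le_mul_of_nonneg_right ?_ (Real.sqrt_nonneg _)
    exact (pow_le_pow_of_le_one hρ0 hρ1.le hk).trans hK.le
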